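/- Let $T>0$, let $p_{\mathrm{data}}$ be a probability measure on $\mathbb{R}^D$ with finite first moment, and let $\alpha,\sigma:[0,T]\to\mathbb{R}$ be noise schedules: absolutely continuous on $[0,T]$, $C^1$ on $(0,T]$, with $\alpha_t>0$ for $0<t<T$ and $\sigma_t>0$ for $0<t\le T$. For $t\in[0,T]$ let $p_t$ be the law of $x_t=\alpha_t x_0+\sigma_t\varepsilon$, where $x_0\sim p_{\mathrm{data}}$ and $\varepsilon\sim\mathcal{N}(0,I)$ are independent. Let $D(x,t)=\mathbb{E}[x_0\mid x_t=x]$ (given by Bayes' formula with the Gaussian likelihood), let $$v(x,t)=\Big(\alpha_t'-\alpha_t\frac{\sigma_t'}{\sigma_t}\Big)D(x,t)+\frac{\sigma_t'}{\sigma_t}\,x ,$$ and let $\Psi_{t\to s}(x)=x+\int_t^s v(x_u,u)\,\mathrm{d}u$ be the flow map of the probability-flow ODE, where $u\mapsto x_u$ solves $\frac{\mathrm{d}x_u}{\mathrm{d}u}=v(x_u,u)$ with $x_t=x$. Let $t$ be random with any law on $[0,T]$ (for example uniform), let $w:\mathbb{R}\to[0,\infty)$ and $d:\mathbb{R}^D\times\mathbb{R}^D\to[0,\infty)$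 be measurable, and let $f_\theta(x,t)\in\mathbb{R}^D$ be a family of models, jointly measurable in $(x,t)$ for each parameter $\theta$. Assume that the prior $p_{\mathrm{prior}}$ equals the diffused marginal $p_T$. Then for every $t\in[0,T]$ and $p_t$-almost every $x$, the probability-flow ODE has exactly one solution on $[0,t]$ that passes through $x$ at time $t$, and for every $\theta$ the oracle consistency-model loss $$\mathcal{L}(\theta)=\mathbb{E}_t\,\mathbb{E}_{x_t\sim p_t}\big[w(t)\,d\big(f_\theta(x_t,t),\Psi_{t\to0}(x_t)\big)\big]\in[0,\infty]$$ satisfies $$\mathcal{L}(\theta)=\mathbb{E}_t\,\mathbb{E}_{x_T\sim p_{\mathrm{prior}}}\big[w(t)\,d\big(f_\theta(\Psi_{T\to t}(x_T),t),\Psi_{T\to0}(x_T)\big)\big].$$ -/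

import Mathlib

open MeasureTheory ProbabilityTheory Set
open scoped NNReal ENNReal

noncomputable section

/-- The sample space `ℝ^D` with its Euclidean norm. -/
abbrev Space (D : ℕ) : Type := EuclideanSpace ℝ (Fin D)

/-- Noise schedules `(α, σ)` on `[0, T]`: `α` and `σ` are absolutely continuous on `[0, T]`, of class
`C¹` on `(0, T]` (at `0` a derivative may blow up, as for `σ t = √t`), the signal level `α` is
positive before `T` (it may vanish at `T`), and the noise level `σ` is positive after `0` (it may
vanish at `0`). -/
structure IsNoiseSchedule (T : ℝ) (α σ : ℝ → ℝ) : Prop where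
  continuousOn_signal : ContinuousOn α (Icc 0 T)
  continuousOn_noise : ContinuousOn σ (Icc 0 T)
  contDiffOn_signal : ContDiffOn ℝ 1 α (Ioc 0 T)
  contDiffOn_noise : ContDiffOn ℝ 1 σ (Ioc 0 T)
  integrableOn_signal : IntegrableOn (derivWithin α (Ioc 0 T)) (Ioc 0 T)
  integrableOn_noise : IntegrableOn (derivWithin σ (Ioc 0 T)) (Ioc 0 T)
  signal_pos : ∀ t ∈ Ioo 0 T, 0 < α t
  noise_pos : ∀ t ∈ Ioc 0 T, 0 < σ t

/-- The diffused marginal `p_t`: the law of `x_t = α_t x₀ + σ_t ε`, where `x₀ ∼ p_data` and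
`ε ∼ N(0, I)` are independent. -/
def marginal {D : ℕ} (pdata : Measure (Space D)) (α σ : ℝ → ℝ) (t : ℝ) : Measure (Space D) :=
  (pdata.prod (stdGaussian (Space D))).map (fun z => α t • z.1 + σ t • z.2)

/-- The conditional law of `x₀` given `x_t = x`, by Bayes' formula: its density with respect to
`p_data` is proportional to the Gaussian likelihood `x₀ ↦ exp (-‖x - α_t x₀‖² / (2 σ_t²))`. -/
def dataPosterior {D : ℕ} (pdata : Measure (Space D)) (α σ : ℝ → ℝ) (t : ℝ) (x : Space D) :
    Measure (Space D) :=
  pdata.tilted (fun x₀ => -(‖x - α t • x₀‖ ^ 2 / (2 * σ t ^ 2)))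

/-- The ideal denoiser `D(x, t) = 𝔼[x₀ | x_t = x]`. -/
def denoiser {D : ℕ} (pdata : Measure (Space D)) (α σ : ℝ → ℝ) (t : ℝ) (x : Space D) : Space D :=
  ∫ x₀, x₀ ∂(dataPosterior pdata α σ t x)

/-- The drift of the probability-flow ODE,
`v(x, t) = (α_t' - α_t σ_t' / σ_t) D(x, t) + (σ_t' / σ_t) x`. -/
def velocity {D : ℕ} (pdata : Measure (Space D)) (T : ℝ) (α σ : ℝ → ℝ) (t : ℝ) (x : Space D) :
    Space D :=
  (derivWithin α (Ioc 0 T) t - α t * (derivWithin σ (Ioc 0 T) t / σ t)) • denoiser pdata α σ t x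
    + (derivWithin σ (Ioc 0 T) t / σ t) • x

/-- `γ` solves `γ' = v(γ, ·)` with `γ t = x` on the interval between `t` and `s`, in integrated
form: `γ r = x + ∫_t^r v(γ u, u) du`. -/
def IsSolution {D : ℕ} (v : ℝ → Space D → Space D) (t s : ℝ) (x : Space D) (γ : ℝ → Space D) :
    Prop :=
  IntervalIntegrable (fun u => v u (γ u)) volume t s ∧
    ∀ r ∈ uIcc t s, γ r = x + ∫ u in t..r, v u (γ u)

/-- The initial value problem `γ' = v(γ, ·)`, `γ t = x` has exactly one solution on the interval
between `t` and `s`. -/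
def HasUniqueSolution {D : ℕ} (v : ℝ → Space D → Space D) (t s : ℝ) (x : Space D) : Prop :=
  ∃ γ, IsSolution v t s x γ ∧ ∀ γ', IsSolution v t s x γ' → EqOn γ' γ (uIcc t s)

open Classical in
/-- The flow map `Ψ_{t → s}(x) = x + ∫_t^s v(x_u, u) du`, where `u ↦ x_u` is the solution that
passes through `x` at time `t` (and `0` where there is no solution). -/
def flowMap {D : ℕ} (v : ℝ → Space D → Space D) (t s : ℝ) (x : Space D) : Space D :=
  if h : ∃ γ, IsSolution v t s x γ then h.choose s else 0

/-- The oracle consistency-model loss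
`𝔼_t 𝔼_{x_t ∼ p_t} [w(t) d(f(x_t, t), Ψ_{t → 0}(x_t))]`, as an element of `[0, ∞]`. -/
def oracleLoss {D : ℕ} (pdata : Measure (Space D)) (T : ℝ) (α σ : ℝ → ℝ) (timeLaw : Measure ℝ)
    (w : ℝ → ℝ≥0) (d : Space D → Space D → ℝ≥0) (f : Space D → ℝ → Space D) : ℝ≥0∞ :=
  ∫⁻ t, ∫⁻ x, ((w t * d (f x t) (flowMap (velocity pdata T α σ) t 0 x) : ℝ≥0) : ℝ≥0∞)
    ∂(marginal pdata α σ t) ∂timeLaw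

end

/-! Everything rests on one fact: the flow of the probability-flow ODE carries `p_t` to `p_s` for `0
≤ s ≤ t ≤ T`. Given this, `x_t` can be replaced by `Ψ_{T→t}(x_T)`, and the semigroup law `Ψ_{t→0} ∘
Ψ_{T→t} = Ψ_{T→0}`, valid almost everywhere, identifies the two losses at each fixed `t`
(`lintegral_flowMap_pair`).

For `0 < s` the transport is proved by duality. The drift is the conditional expectation of the
interpolant's velocity `α' x₀ + σ' ε` given `x_t` (`integral_clm_interpolantVelocity`). For a
Lipschitz test function `φ` of bounded support put `g_r = φ ∘ Ψ_{r→s}`. Formally, the derivative in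
`r` of `𝔼 g_r(x_r)` is `𝔼 [∇g_r(x_r) · (α' x₀ + σ' ε - v(x_r, r))] = 0`, so the mean is constant. A
Lipschitz flow suffices: Rademacher's theorem provides `∇g_r` almost everywhere, and `p_r` is
absolutely continuous. The drift is only locally Lipschitz, so this is carried out for truncated
drifts (`exists_forall_integral_globalFlow_eq`). The linear growth of the denoiser
(`norm_denoiser_le`) confines trajectories independently of the truncation radius, which is then
sent to infinity. The growth bound can fail at `T`, where `α` may vanish; that time is reached by a
limit.

At time zero the drift may be singular, and solutions come from finite expected length. By transport
and Jensen's inequality, the mean speed at time `u` is at most `|α'_u| 𝔼‖x₀‖ + |σ'_u| 𝔼‖ε‖`, which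
is integrable in `u` because the schedules are absolutely continuous. Tonelli's theorem then shows
that almost every trajectory has finite length, hence extends to time zero
(`ae_integrableOn_velocity_flowMap`). Uniqueness, transport and the semigroup law at zero follow by
letting positive times tend to zero. -/

open Filter Topology

/-! ### Gaussian density and the joint law of data and noised sample -/

/-- The standard Gaussian has a density proportional to `exp (-‖x‖² / 2)`. -/
theorem stdGaussian_eq_withDensity (D : ℕ) : ∃ c : ℝ, 0 < c ∧
    stdGaussian (Space D) =
      volume.withDensity (fun x => ENNReal.ofReal (c * Real.exp (-(‖x‖ ^ 2 / 2)))) := by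
  have hint : Integrable (fun x : Space D => Real.exp (-(‖x‖ ^ 2 / 2))) := by
    have := (GaussianFourier.integrable_cexp_neg_mul_sq_norm_add (V := Space D)
      (b := 1 / 2) (by norm_num) 0 0).norm
    refine this.congr (.of_forall fun x => ?_)
    simp only [zero_mul, add_zero, Complex.norm_exp]
    congr 1
    norm_cast
    rw [← Complex.ofReal_ofNat, ← Complex.ofReal_one, ← Complex.ofReal_div, ← Complex.ofReal_neg,
      ← Complex.ofReal_mul, Complex.ofReal_re]
    ring
  refine ⟨((2 * Real.pi) ^ ((D : ℝ) / 2))⁻¹, by positivity, ?_⟩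
  set c : ℝ := ((2 * Real.pi) ^ ((D : ℝ) / 2))⁻¹ with hc
  have hcpos : 0 < c := by positivity
  have hfin : IsFiniteMeasure ((volume : Measure (Space D)).withDensity
      (fun x => ENNReal.ofReal (c * Real.exp (-(‖x‖ ^ 2 / 2))))) :=
    isFiniteMeasure_withDensity_ofReal (hint.const_mul c).2
  -- Characteristic functions identify the two finite measures; the Gaussian Fourier integral also
  -- confirms the normalizing constant.
  refine Measure.ext_of_charFun (funext fun t => ?_)
  rw [charFun_stdGaussian, charFun_apply,
    integral_withDensity_eq_integral_toReal_smul (by fun_prop) (by simp)]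
  have h1 : ∀ x : Space D, (ENNReal.ofReal (c * Real.exp (-(‖x‖ ^ 2 / 2)))).toReal •
      Complex.exp (inner ℝ x t * Complex.I) =
      c * Complex.exp (-(1 / 2 : ℂ) * ‖x‖ ^ 2 + Complex.I * inner ℝ t x) := by
    intro x
    rw [ENNReal.toReal_ofReal (by positivity), Complex.real_smul, real_inner_comm, Complex.exp_add]
    push_cast
    rw [mul_assoc]
    congr 3 <;> ring
  simp_rw [h1]
  rw [integral_const_mul, GaussianFourier.integral_cexp_neg_mul_sq_norm_add (by norm_num),
    ← mul_assoc]
  have h2 : ((c : ℂ) * (Real.pi / (1 / 2 : ℂ)) ^ ((Module.finrank ℝ (Space D) : ℂ) / 2)) = 1 := by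
    have : (Real.pi / (1 / 2 : ℂ)) = ((2 * Real.pi : ℝ) : ℂ) := by push_cast; ring
    rw [this, finrank_euclideanSpace_fin]
    have : ((D : ℂ) / 2) = (((D : ℝ) / 2 : ℝ) : ℂ) := by push_cast; ring
    rw [this, ← Complex.ofReal_cpow (by positivity), ← Complex.ofReal_mul, hc,
      inv_mul_cancel₀ (by positivity), Complex.ofReal_one]
  rw [h2, one_mul]
  congr 1
  rw [Complex.I_sq]
  ring

/-- The Gaussian likelihood of an observation `x = a x₀ + b ε`, up to normalization. -/
noncomputable def likelihood {D : ℕ} (a b : ℝ) (x x₀ : Space D) : ℝ :=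
  Real.exp (-(‖x - a • x₀‖ ^ 2 / (2 * b ^ 2)))

section Likelihood

variable {D : ℕ} {a b : ℝ}

theorem likelihood_pos (x x₀ : Space D) : 0 < likelihood a b x x₀ := Real.exp_pos _

theorem likelihood_le_one (x x₀ : Space D) : likelihood a b x x₀ ≤ 1 := by
  rw [likelihood, Real.exp_le_one_iff]
  have : 0 ≤ ‖x - a • x₀‖ ^ 2 / (2 * b ^ 2) := by positivity
  linarith

theorem continuous_likelihood :
    Continuous (fun z : Space D × Space D => likelihood a b z.1 z.2) := by
  unfold likelihood
  fun_prop

theorem measurable_likelihood (x : Space D) : Measurable (likelihood a b x) :=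
  (continuous_likelihood.comp (Continuous.prodMk_right x)).measurable

theorem lintegral_comp_add_smul {a : Space D} (hb : b ≠ 0) {G : Space D → ℝ≥0∞}
    (hG : Measurable G) :
    ∫⁻ e, G (a + b • e) = ENNReal.ofReal |(b ^ D)⁻¹| * ∫⁻ y, G y := by
  have h1 : ∫⁻ e, G (a + b • e) = ∫⁻ y, G (a + y) ∂((volume : Measure (Space D)).map (b • ·)) := by
    rw [lintegral_map (by fun_prop) (by fun_prop)]
  rw [h1, Measure.map_addHaar_smul _ hb, lintegral_smul_measure, finrank_euclideanSpace_fin,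
    lintegral_add_left_eq_self, smul_eq_mul]

/-- The joint law of `(x₀, a x₀ + b ε)` has density proportional to the likelihood. -/
theorem map_prod_stdGaussian_eq_withDensity (pdata : Measure (Space D)) [IsProbabilityMeasure pdata]
    (a : ℝ) (hb : b ≠ 0) : ∃ c : ℝ, 0 < c ∧
    (pdata.prod (stdGaussian (Space D))).map (fun z => (z.1, a • z.1 + b • z.2)) =
      (pdata.prod volume).withDensity
        (fun z => ENNReal.ofReal (c * likelihood a b z.2 z.1)) := by
  obtain ⟨c, hc, hg⟩ := stdGaussian_eq_withDensity D
  refine ⟨|(b ^ D)⁻¹| * c, by positivity, Measure.ext_of_lintegral _ fun F hF => ?_⟩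
  have hlik : Measurable fun z : Space D × Space D => likelihood a b z.2 z.1 :=
    (continuous_likelihood.comp continuous_swap).measurable
  have hden : Measurable fun z : Space D × Space D =>
      ENNReal.ofReal (|(b ^ D)⁻¹| * c * likelihood a b z.2 z.1) := by fun_prop
  have hgauss : Measurable fun e : Space D => ENNReal.ofReal (c * Real.exp (-(‖e‖ ^ 2 / 2))) := by
    fun_prop
  have hmap : Measurable fun z : Space D × Space D => (z.1, a • z.1 + b • z.2) := by fun_prop
  have hFc : Measurable fun z : Space D × Space D => F (z.1, a • z.1 + b • z.2) := hF.comp hmap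
  rw [lintegral_map hF hmap, lintegral_withDensity_eq_lintegral_mul _ hden hF,
    lintegral_prod _ hFc.aemeasurable, lintegral_prod _ (hden.mul hF).aemeasurable]
  refine lintegral_congr fun x₀ => ?_
  set G : Space D → ℝ≥0∞ := fun y => ENNReal.ofReal (c * likelihood a b y x₀) * F (x₀, y) with hGdef
  have hG : Measurable G := by
    have h1 : Measurable fun y => likelihood a b y x₀ := by unfold likelihood; fun_prop
    have h2 : Measurable fun y => F (x₀, y) := hF.comp (by fun_prop)
    exact (h1.const_mul c).ennreal_ofReal.mul h2
  have hF' : Measurable fun e => F (x₀, a • x₀ + b • e) :=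
    hF.comp (by fun_prop : Measurable fun e => (x₀, a • x₀ + b • e))
  rw [hg, lintegral_withDensity_eq_lintegral_mul _ hgauss hF']
  calc _ = ∫⁻ e, G (a • x₀ + b • e) := by
        refine lintegral_congr fun e => ?_
        simp only [hGdef, Pi.mul_apply, likelihood, add_sub_cancel_left, norm_smul,
          Real.norm_eq_abs, mul_pow, sq_abs]
        congr 5
        field_simp
    _ = _ := by
        rw [lintegral_comp_add_smul hb hG, ← lintegral_const_mul _ hG]
        refine lintegral_congr fun y => ?_
        simp only [hGdef, Pi.mul_apply]
        rw [mul_assoc, ENNReal.ofReal_mul (abs_nonneg _), mul_assoc]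

end Likelihood

/-! ### Growth, continuity and Lipschitz bounds for the denoiser -/

section Denoiser

variable {D : ℕ} {a b : ℝ} {pdata : Measure (Space D)}

/-- The normalization of the posterior: the integral of the likelihood over the data. -/
noncomputable def evidence (pdata : Measure (Space D)) (a b : ℝ) (x : Space D) : ℝ :=
  ∫ x₀, likelihood a b x x₀ ∂pdata

/-- The unnormalized posterior mean. -/
noncomputable def weightedMean (pdata : Measure (Space D)) (a b : ℝ) (x : Space D) : Space D :=
  ∫ x₀, likelihood a b x x₀ • x₀ ∂pdata

/-- The quotient form separates two integrals that are each bounded and Lipschitz in `x`. -/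
theorem denoiser_eq (α σ : ℝ → ℝ) (t : ℝ) (x : Space D) :
    denoiser pdata α σ t x =
      (evidence pdata (α t) (σ t) x)⁻¹ • weightedMean pdata (α t) (σ t) x := by
  rw [denoiser, dataPosterior, integral_tilted, weightedMean, ← integral_smul]
  refine integral_congr_ae (.of_forall fun x₀ => ?_)
  simp only [evidence, likelihood, smul_smul, div_eq_inv_mul]

theorem norm_likelihood_le_one (x x₀ : Space D) : ‖likelihood a b x x₀‖ ≤ 1 := by
  rw [Real.norm_of_nonneg (likelihood_pos x x₀).le]
  exact likelihood_le_one x x₀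

theorem integrable_likelihood [IsFiniteMeasure pdata] (x : Space D) :
    Integrable (likelihood a b x) pdata :=
  .of_bound (measurable_likelihood x).aestronglyMeasurable 1
    (.of_forall fun x₀ => norm_likelihood_le_one x x₀)

theorem MeasureTheory.Integrable.likelihood_smul {E : Type*} [NormedAddCommGroup E] [NormedSpace ℝ E]
    {g : Space D → E} (hg : Integrable g pdata) (x : Space D) :
    Integrable (fun x₀ => likelihood a b x x₀ • g x₀) pdata :=
  hg.bdd_smul 1 (measurable_likelihood x).aestronglyMeasurable
    (.of_forall fun x₀ => norm_likelihood_le_one x x₀)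

theorem evidence_pos [IsProbabilityMeasure pdata] (x : Space D) : 0 < evidence pdata a b x :=
  integral_exp_pos (integrable_likelihood x)

theorem abs_likelihood_sub_le (hb : 0 < b) (x y x₀ : Space D) :
    |likelihood a b x x₀ - likelihood a b y x₀| ≤ b⁻¹ * ‖x - y‖ := by
  have hderiv : ∀ u : ℝ, HasDerivAt (fun u : ℝ => Real.exp (-(u ^ 2 / (2 * b ^ 2))))
      (Real.exp (-(u ^ 2 / (2 * b ^ 2))) * -(2 * u / (2 * b ^ 2))) u := fun u => by
    simpa using! (((hasDerivAt_pow 2 u).div_const (2 * b ^ 2)).neg).exp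
  have hbound : ∀ u : ℝ,
      ‖Real.exp (-(u ^ 2 / (2 * b ^ 2))) * -(2 * u / (2 * b ^ 2))‖ ≤ b⁻¹ := fun u => by
    have h1 : ‖Real.exp (-(u ^ 2 / (2 * b ^ 2))) * -(2 * u / (2 * b ^ 2))‖ =
        |u / b| * Real.exp (-((u / b) ^ 2 / 2)) * b⁻¹ := by
      rw [norm_mul, norm_neg, Real.norm_eq_abs, Real.norm_eq_abs, Real.abs_exp, abs_div, abs_div,
        abs_mul, abs_mul, abs_of_pos hb, abs_of_pos (by positivity : (0 : ℝ) < 2),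
        abs_of_pos (by positivity : 0 < b ^ 2)]
      have : u ^ 2 / (2 * b ^ 2) = (u / b) ^ 2 / 2 := by field_simp
      rw [this]
      field_simp
    rw [h1]
    refine mul_le_of_le_one_left (by positivity) ?_
    have h2 := Real.add_one_le_exp ((u / b) ^ 2 / 2)
    rw [Real.exp_neg, ← div_eq_mul_inv, div_le_one (Real.exp_pos _)]
    -- With `r = |u / b|`: `r ≤ 1 + r² / 2 ≤ exp (r² / 2)`.
    nlinarith [sq_nonneg (|u / b| - 1), sq_abs (u / b)]
  have := convex_univ.norm_image_sub_le_of_norm_hasDerivWithin_le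
    (fun u _ => (hderiv u).hasDerivWithinAt) (fun u _ => hbound u)
    (mem_univ ‖y - a • x₀‖) (mem_univ ‖x - a • x₀‖)
  rw [Real.norm_eq_abs, Real.norm_eq_abs] at this
  refine this.trans (mul_le_mul_of_nonneg_left ?_ (by positivity))
  simpa using abs_norm_sub_norm_le (x - a • x₀) (y - a • x₀)

theorem abs_evidence_sub_le [IsProbabilityMeasure pdata] (hb : 0 < b) (x y : Space D) :
    |evidence pdata a b x - evidence pdata a b y| ≤ b⁻¹ * ‖x - y‖ := by
  rw [evidence, evidence, ← integral_sub (integrable_likelihood x) (integrable_likelihood y)]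
  have := norm_integral_le_of_norm_le_const (μ := pdata)
    (f := fun x₀ => likelihood a b x x₀ - likelihood a b y x₀)
    (.of_forall fun x₀ => abs_likelihood_sub_le hb x y x₀)
  rwa [probReal_univ, mul_one] at this

theorem norm_weightedMean_sub_le (hmoment : Integrable (fun x : Space D => x) pdata)
    (hb : 0 < b) (x y : Space D) :
    ‖weightedMean pdata a b x - weightedMean pdata a b y‖ ≤
      (∫ x₀, ‖x₀‖ ∂pdata) * b⁻¹ * ‖x - y‖ := by
  rw [weightedMean, weightedMean, ← integral_sub (hmoment.likelihood_smul x)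
    (hmoment.likelihood_smul y), mul_assoc, ← integral_mul_const]
  refine norm_integral_le_of_norm_le (hmoment.norm.mul_const _) (.of_forall fun x₀ => ?_)
  rw [← sub_smul, norm_smul, mul_comm]
  exact mul_le_mul_of_nonneg_left (abs_likelihood_sub_le hb x y x₀) (norm_nonneg _)

theorem norm_weightedMean_le (hmoment : Integrable (fun x : Space D => x) pdata) (x : Space D) :
    ‖weightedMean pdata a b x‖ ≤ ∫ x₀, ‖x₀‖ ∂pdata := by
  refine norm_integral_le_of_norm_le hmoment.norm (.of_forall fun x₀ => ?_)
  rw [norm_smul]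
  exact mul_le_of_le_one_left (norm_nonneg _) (norm_likelihood_le_one x x₀)

theorem continuousAt_likelihood {p : ℝ × ℝ × Space D} (hp : p.2.1 ≠ 0) (x₀ : Space D) :
    ContinuousAt (fun p : ℝ × ℝ × Space D => likelihood p.1 p.2.1 p.2.2 x₀) p := by
  unfold likelihood
  have : 2 * p.2.1 ^ 2 ≠ 0 := by positivity
  fun_prop (disch := assumption)

/-- Dominated convergence with the constant bound 1. Continuity jointly in the schedule values and
in `x` is what yields continuity in `(t, x)` after composition with the schedules. -/
theorem continuousAt_evidence [IsProbabilityMeasure pdata] {p : ℝ × ℝ × Space D}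
    (hp : p.2.1 ≠ 0) :
    ContinuousAt (fun p : ℝ × ℝ × Space D => evidence pdata p.1 p.2.1 p.2.2) p :=
  continuousAt_of_dominated
    (.of_forall fun q => (measurable_likelihood q.2.2).aestronglyMeasurable)
    (.of_forall fun q => .of_forall fun x₀ => norm_likelihood_le_one q.2.2 x₀)
    (integrable_const (1 : ℝ)) (.of_forall fun x₀ => continuousAt_likelihood hp x₀)

theorem continuousAt_weightedMean (hmoment : Integrable (fun x : Space D => x) pdata)
    {p : ℝ × ℝ × Space D} (hp : p.2.1 ≠ 0) :
    ContinuousAt (fun p : ℝ × ℝ × Space D => weightedMean pdata p.1 p.2.1 p.2.2) p := by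
  refine continuousAt_of_dominated
    (.of_forall fun q => (hmoment.likelihood_smul q.2.2).aestronglyMeasurable)
    (.of_forall fun q => .of_forall fun x₀ => ?_)
    hmoment.norm (.of_forall fun x₀ => (continuousAt_likelihood hp x₀).smul continuousAt_const)
  rw [norm_smul]
  exact mul_le_of_le_one_left (norm_nonneg _) (norm_likelihood_le_one q.2.2 x₀)

/-- The likelihood decreases with the distance to the observation, so that weighting by it
decreases the mean distance. -/
theorem integral_likelihood_mul_norm_le [IsProbabilityMeasure pdata]
    (hmoment : Integrable (fun x : Space D => x) pdata) (hb : 0 < b) (x : Space D) :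
    ∫ x₀, likelihood a b x x₀ * ‖x - a • x₀‖ ∂pdata ≤
      (∫ x₀, ‖x - a • x₀‖ ∂pdata) * evidence pdata a b x := by
  have hg : Integrable (fun x₀ => ‖x - a • x₀‖) pdata :=
    ((integrable_const x).sub (hmoment.smul a)).norm
  set m := ∫ x₀, ‖x - a • x₀‖ ∂pdata with hm
  set wm := Real.exp (-(m ^ 2 / (2 * b ^ 2))) with hwm
  have hm0 : 0 ≤ m := integral_nonneg fun _ => norm_nonneg _
  clear_value m
  -- Chebyshev's correlation argument: the likelihood decreases in the distance and equals `wm` at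
  -- distance `m`, so distance minus `m` and likelihood minus `wm` have opposite signs. The last
  -- term integrates to zero because `m` is the mean distance.
  have hpt : ∀ x₀, likelihood a b x x₀ * ‖x - a • x₀‖ ≤
      m * likelihood a b x x₀ + wm * (‖x - a • x₀‖ - m) := by
    intro x₀
    have h : (‖x - a • x₀‖ - m) * (likelihood a b x x₀ - wm) ≤ 0 := by
      have hden : 0 ≤ 2 * b ^ 2 := by positivity
      rcases le_total ‖x - a • x₀‖ m with h | h
      · exact mul_nonpos_of_nonpos_of_nonneg (sub_nonpos.2 h) (sub_nonneg.2 (Real.exp_le_exp.2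
          (neg_le_neg (div_le_div_of_nonneg_right (pow_le_pow_left₀ (norm_nonneg _) h 2) hden))))
      · exact mul_nonpos_of_nonneg_of_nonpos (sub_nonneg.2 h) (sub_nonpos.2 (Real.exp_le_exp.2
          (neg_le_neg (div_le_div_of_nonneg_right (pow_le_pow_left₀ hm0 h 2) hden))))
    linarith
  have h1 : Integrable (fun x₀ => likelihood a b x x₀ * ‖x - a • x₀‖) pdata := by
    simpa only [smul_eq_mul] using hg.likelihood_smul (a := a) (b := b) x
  have h2 := (integrable_likelihood (a := a) (b := b) (pdata := pdata) x).const_mul m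
  have h3 : Integrable (fun x₀ => wm * (‖x - a • x₀‖ - m)) pdata :=
    (hg.sub (integrable_const m)).const_mul wm
  have h4 := integral_mono h1 (h2.add h3) hpt
  refine h4.trans (le_of_eq ?_)
  simp only [Pi.add_apply]
  rw [integral_add h2 h3, integral_const_mul, integral_const_mul, integral_sub hg
    (integrable_const m)]
  simp [← hm, evidence]

/-- Since `a‖x₀‖ ≤ ‖x - a x₀‖ + ‖x‖`, the correlation inequality yields a bound linear in `‖x‖` that
involves neither `b` nor a lower bound on the evidence. The growth control of the drift over all of
space comes from here. -/
theorem norm_weightedMean_le_evidence [IsProbabilityMeasure pdata]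
    (hmoment : Integrable (fun x : Space D => x) pdata) (ha : 0 < a) (hb : 0 < b) (x : Space D) :
    ‖weightedMean pdata a b x‖ ≤
      (2 * a⁻¹ * ‖x‖ + ∫ x₀, ‖x₀‖ ∂pdata) * evidence pdata a b x := by
  have hg : Integrable (fun x₀ => ‖x - a • x₀‖) pdata :=
    ((integrable_const x).sub (hmoment.smul a)).norm
  have hlik := integrable_likelihood (a := a) (b := b) (pdata := pdata) x
  have h1 : Integrable (fun x₀ => likelihood a b x x₀ * ‖x - a • x₀‖) pdata := by
    simpa only [smul_eq_mul] using hg.likelihood_smul (a := a) (b := b) x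
  have h2 : ‖weightedMean pdata a b x‖ ≤ ∫ x₀, a⁻¹ * (likelihood a b x x₀ * ‖x - a • x₀‖ +
      likelihood a b x x₀ * ‖x‖) ∂pdata := by
    refine norm_integral_le_of_norm_le ((h1.add (hlik.mul_const _)).const_mul _)
      (.of_forall fun x₀ => ?_)
    rw [norm_smul, Real.norm_of_nonneg (likelihood_pos x x₀).le, ← mul_add, mul_left_comm]
    refine mul_le_mul_of_nonneg_left ?_ (likelihood_pos x x₀).le
    rw [← div_eq_inv_mul, le_div_iff₀ ha]
    have := norm_sub_norm_le (a • x₀) x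
    rw [norm_smul, Real.norm_of_nonneg ha.le, norm_sub_rev] at this
    linarith
  rw [integral_const_mul, integral_add h1 (hlik.mul_const _), integral_mul_const] at h2
  have h3 := integral_likelihood_mul_norm_le (a := a) hmoment hb x
  have h4 : ∫ x₀, ‖x - a • x₀‖ ∂pdata ≤ ‖x‖ + a * ∫ x₀, ‖x₀‖ ∂pdata := by
    have : ∫ x₀, ‖x - a • x₀‖ ∂pdata ≤ ∫ x₀, (‖x‖ + a * ‖x₀‖) ∂pdata := by
      refine integral_mono hg ((integrable_const _).add (hmoment.norm.const_mul a)) fun x₀ => ?_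
      have := norm_sub_le x (a • x₀)
      rwa [norm_smul, Real.norm_of_nonneg ha.le] at this
    rwa [integral_add (integrable_const _) (hmoment.norm.const_mul a), integral_const_mul,
      integral_const, probReal_univ, one_smul] at this
  have hZ := (evidence_pos (pdata := pdata) (a := a) (b := b) x).le
  refine h2.trans ?_
  calc _ ≤ a⁻¹ * ((‖x‖ + a * ∫ x₀, ‖x₀‖ ∂pdata) * evidence pdata a b x
        + evidence pdata a b x * ‖x‖) := by
        gcongr
        · exact h3.trans (mul_le_mul_of_nonneg_right h4 hZ)
        · exact le_rfl
    _ = _ := by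
        field_simp
        ring

theorem norm_denoiser_le [IsProbabilityMeasure pdata]
    (hmoment : Integrable (fun x : Space D => x) pdata) {α σ : ℝ → ℝ} {t : ℝ}
    (ha : 0 < α t) (hb : 0 < σ t) (x : Space D) :
    ‖denoiser pdata α σ t x‖ ≤ 2 * (α t)⁻¹ * ‖x‖ + ∫ x₀, ‖x₀‖ ∂pdata := by
  have hZ := evidence_pos (pdata := pdata) (a := α t) (b := σ t) x
  rw [denoiser_eq, norm_smul, norm_inv, Real.norm_of_nonneg hZ.le, inv_mul_le_iff₀ hZ, mul_comm]
  exact norm_weightedMean_le_evidence hmoment ha hb x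

/-- A difference of quotients. In the application `z` is a lower bound for the evidence on a compact
set, so the Lipschitz constant is only locally uniform. -/
theorem norm_denoiser_sub_le [IsProbabilityMeasure pdata]
    (hmoment : Integrable (fun x : Space D => x) pdata) {α σ : ℝ → ℝ} {t z : ℝ}
    (hb : 0 < σ t) (hz : 0 < z) {x y : Space D} (hx : z ≤ evidence pdata (α t) (σ t) x)
    (hy : z ≤ evidence pdata (α t) (σ t) y) :
    ‖denoiser pdata α σ t x - denoiser pdata α σ t y‖ ≤
      (∫ x₀, ‖x₀‖ ∂pdata) * (σ t)⁻¹ * (z⁻¹ + z⁻¹ * z⁻¹) * ‖x - y‖ := by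
  set m := ∫ x₀, ‖x₀‖ ∂pdata with hm
  have hm0 : 0 ≤ m := integral_nonneg fun _ => norm_nonneg _
  have hx0 := hz.trans_le hx
  have hy0 := hz.trans_le hy
  rw [denoiser_eq, denoiser_eq]
  set Zx := evidence pdata (α t) (σ t) x
  set Zy := evidence pdata (α t) (σ t) y
  have h1 : Zx⁻¹ • weightedMean pdata (α t) (σ t) x - Zy⁻¹ • weightedMean pdata (α t) (σ t) y =
      Zx⁻¹ • (weightedMean pdata (α t) (σ t) x - weightedMean pdata (α t) (σ t) y) +
      ((Zx⁻¹ * Zy⁻¹) * (Zy - Zx)) • weightedMean pdata (α t) (σ t) y := by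
    have : (Zx⁻¹ * Zy⁻¹) * (Zy - Zx) = Zx⁻¹ - Zy⁻¹ := by field_simp
    rw [this, smul_sub, sub_smul]
    abel
  have hxi : Zx⁻¹ ≤ z⁻¹ := inv_anti₀ hz hx
  have hyi : Zy⁻¹ ≤ z⁻¹ := inv_anti₀ hz hy
  have hxi0 : 0 ≤ Zx⁻¹ := by positivity
  have hyi0 : 0 ≤ Zy⁻¹ := by positivity
  rw [h1]
  refine (norm_add_le _ _).trans ?_
  rw [norm_smul, norm_smul, norm_mul, norm_mul, Real.norm_of_nonneg hxi0,
    Real.norm_of_nonneg hyi0]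
  have e1 := norm_weightedMean_sub_le (a := α t) hmoment hb x y
  have e2 : ‖Zy - Zx‖ ≤ (σ t)⁻¹ * ‖x - y‖ := by
    rw [norm_sub_rev]
    exact abs_evidence_sub_le hb x y
  have e3 := norm_weightedMean_le (a := α t) (b := σ t) hmoment y
  rw [← hm] at e1 e3
  calc _ ≤ z⁻¹ * (m * (σ t)⁻¹ * ‖x - y‖) + z⁻¹ * z⁻¹ * ((σ t)⁻¹ * ‖x - y‖) * m := by gcongr
    _ = _ := by ring

end Denoiser

/-! ### Grönwall estimates and flows of bounded Lipschitz fields -/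

/-- Grönwall in both time directions: `e u * exp (C u)` is nondecreasing and `e u * exp (-C u)` is
nonincreasing. -/
theorem le_exp_mul_of_abs_deriv_le {e e' : ℝ → ℝ} {C a b : ℝ}
    (hcont : ContinuousOn e (Icc a b)) (hderiv : ∀ u ∈ Ioo a b, HasDerivAt e (e' u) u)
    (hbound : ∀ u ∈ Ioo a b, |e' u| ≤ C * e u) {r t : ℝ} (hr : r ∈ Icc a b) (ht : t ∈ Icc a b) :
    e r ≤ Real.exp (C * |r - t|) * e t := by
  have key : ∀ c : ℝ, ∀ u ∈ Ioo a b, HasDerivAt (fun u => e u * Real.exp (c * u))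
      ((e' u + c * e u) * Real.exp (c * u)) u := fun c u hu => by
    have h1 : HasDerivAt (fun u => Real.exp (c * u)) (Real.exp (c * u) * c) u := by
      simpa using ((hasDerivAt_id u).const_mul c).exp
    exact ((hderiv u hu).mul h1).congr_deriv (by ring)
  have hc : ∀ c : ℝ, ContinuousOn (fun u => e u * Real.exp (c * u)) (Icc a b) := fun c =>
    hcont.mul (by fun_prop)
  have hint : interior (Icc a b) = Ioo a b := interior_Icc
  rcases le_total r t with hrt | hrt
  · have hmono : MonotoneOn (fun u => e u * Real.exp (C * u)) (Icc a b) := by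
      refine monotoneOn_of_deriv_nonneg (convex_Icc a b) (hc C) (fun u hu => ?_) fun u hu => ?_
      · exact (key C u (hint ▸ hu)).differentiableAt.differentiableWithinAt
      · rw [hint] at hu
        rw [(key C u hu).deriv]
        exact mul_nonneg (by linarith [neg_abs_le (e' u), hbound u hu]) (Real.exp_pos _).le
    have := hmono hr ht hrt
    rw [abs_of_nonpos (by linarith)]
    have h2 : Real.exp (C * -(r - t)) = Real.exp (C * t) * (Real.exp (C * r))⁻¹ := by
      rw [← Real.exp_neg, ← Real.exp_add]; ring_nf
    rw [h2, mul_right_comm, ← div_eq_mul_inv, le_div_iff₀ (Real.exp_pos _), mul_comm _ (e t)]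
    exact this
  · have hanti : AntitoneOn (fun u => e u * Real.exp (-C * u)) (Icc a b) := by
      refine antitoneOn_of_deriv_nonpos (convex_Icc a b) (hc (-C)) (fun u hu => ?_) fun u hu => ?_
      · exact (key (-C) u (hint ▸ hu)).differentiableAt.differentiableWithinAt
      · rw [hint] at hu
        rw [(key (-C) u hu).deriv]
        exact mul_nonpos_of_nonpos_of_nonneg (by linarith [le_abs_self (e' u), hbound u hu])
          (Real.exp_pos _).le
    have := hanti ht hr hrt
    rw [abs_of_nonneg (by linarith)]
    have h2 : Real.exp (C * (r - t)) = Real.exp (-C * t) * (Real.exp (-C * r))⁻¹ := by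
      rw [← Real.exp_neg, ← Real.exp_add]; ring_nf
    rw [h2, mul_right_comm, ← div_eq_mul_inv, le_div_iff₀ (Real.exp_pos _), mul_comm _ (e t)]
    exact this

section ODE

variable {E : Type*} [NormedAddCommGroup E] [InnerProductSpace ℝ E]

/-- `γ` is an integral curve of `v` on `[a, b]`: continuous there and differentiable inside. -/
structure IsCurveOn (v : ℝ → E → E) (a b : ℝ) (γ : ℝ → E) : Prop where
  continuousOn : ContinuousOn γ (Icc a b)
  hasDerivAt : ∀ u ∈ Ioo a b, HasDerivAt γ (v u (γ u)) u

theorem IsCurveOn.mono {v : ℝ → E → E} {a b a' b' : ℝ} {γ : ℝ → E} (h : IsCurveOn v a b γ)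
    (ha : a ≤ a') (hb : b' ≤ b) : IsCurveOn v a' b' γ :=
  ⟨h.continuousOn.mono (Icc_subset_Icc ha hb), fun u hu => h.hasDerivAt u (Ioo_subset_Ioo ha hb hu)⟩

theorem IsCurveOn.congr_field {v w : ℝ → E → E} {a b : ℝ} {γ : ℝ → E} (h : IsCurveOn v a b γ)
    (hvw : ∀ u ∈ Ioo a b, v u (γ u) = w u (γ u)) : IsCurveOn w a b γ :=
  ⟨h.continuousOn, fun u hu => hvw u hu ▸ h.hasDerivAt u hu⟩

/-- Grönwall is applied to the squared distance, which is differentiable even where the curves meet.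
-/
theorem IsCurveOn.norm_sub_le {v : ℝ → E → E} {a b : ℝ} {γ₁ γ₂ : ℝ → E} {K : ℝ≥0} {S : Set E}
    (h₁ : IsCurveOn v a b γ₁) (h₂ : IsCurveOn v a b γ₂)
    (hv : ∀ u ∈ Ioo a b, LipschitzOnWith K (v u) S)
    (hS₁ : ∀ u ∈ Ioo a b, γ₁ u ∈ S) (hS₂ : ∀ u ∈ Ioo a b, γ₂ u ∈ S)
    {r t : ℝ} (hr : r ∈ Icc a b) (ht : t ∈ Icc a b) :
    ‖γ₁ r - γ₂ r‖ ≤ Real.exp (K * |r - t|) * ‖γ₁ t - γ₂ t‖ := by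
  have key := le_exp_mul_of_abs_deriv_le (e := fun u => ‖γ₁ u - γ₂ u‖ ^ 2) (C := 2 * K)
    ((h₁.continuousOn.sub h₂.continuousOn).norm.pow 2)
    (fun u hu => ((h₁.hasDerivAt u hu).sub (h₂.hasDerivAt u hu)).norm_sq) (fun u hu => ?_) hr ht
  · refine (pow_le_pow_iff_left₀ (norm_nonneg _) (by positivity) two_ne_zero).1 (key.trans_eq ?_)
    rw [mul_pow, ← Real.exp_nat_mul]
    push_cast
    ring_nf
  · have h3 := (hv u hu).dist_le_mul _ (hS₁ u hu) _ (hS₂ u hu)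
    rw [dist_eq_norm, dist_eq_norm] at h3
    have h4 := abs_real_inner_le_norm ((γ₁ - γ₂) u) (v u (γ₁ u) - v u (γ₂ u))
    rw [abs_mul, abs_two]
    simp only [Pi.sub_apply] at h4 ⊢
    nlinarith [norm_nonneg (γ₁ u - γ₂ u), mul_le_mul_of_nonneg_left h3 (norm_nonneg (γ₁ u - γ₂ u))]

theorem IsCurveOn.eqOn {v : ℝ → E → E} {a b : ℝ} {γ₁ γ₂ : ℝ → E} {K : ℝ≥0} {S : Set E}
    (h₁ : IsCurveOn v a b γ₁) (h₂ : IsCurveOn v a b γ₂)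
    (hv : ∀ u ∈ Ioo a b, LipschitzOnWith K (v u) S)
    (hS₁ : ∀ u ∈ Ioo a b, γ₁ u ∈ S) (hS₂ : ∀ u ∈ Ioo a b, γ₂ u ∈ S)
    {t : ℝ} (ht : t ∈ Icc a b) (heq : γ₁ t = γ₂ t) : EqOn γ₁ γ₂ (Icc a b) := fun r hr => by
  have := h₁.norm_sub_le h₂ hv hS₁ hS₂ hr ht
  rw [heq, sub_self, norm_zero, mul_zero] at this
  exact sub_eq_zero.1 (norm_le_zero_iff.1 this)

/-- The factor 3 comes from `2‖γ‖ A (1 + ‖γ‖) ≤ 3 A (1 + ‖γ‖²)`, which bounds the derivative of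
`‖γ‖²`. -/
theorem IsCurveOn.one_add_norm_sq_le {v : ℝ → E → E} {a b A : ℝ} {γ : ℝ → E}
    (h : IsCurveOn v a b γ) (hA : 0 ≤ A)
    (hv : ∀ u ∈ Ioo a b, ‖v u (γ u)‖ ≤ A * (1 + ‖γ u‖))
    {r t : ℝ} (hr : r ∈ Icc a b) (ht : t ∈ Icc a b) :
    1 + ‖γ r‖ ^ 2 ≤ Real.exp (3 * A * |r - t|) * (1 + ‖γ t‖ ^ 2) := by
  refine le_exp_mul_of_abs_deriv_le (e := fun u => 1 + ‖γ u‖ ^ 2)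
    (continuousOn_const.add (h.continuousOn.norm.pow 2))
    (fun u hu => (h.hasDerivAt u hu).norm_sq.const_add 1) (fun u hu => ?_) hr ht
  have h4 := abs_real_inner_le_norm (γ u) (v u (γ u))
  have h5 := mul_le_mul_of_nonneg_left (hv u hu) (norm_nonneg (γ u))
  rw [abs_mul, abs_two]
  nlinarith [norm_nonneg (γ u), mul_nonneg hA (sq_nonneg (‖γ u‖ - 1))]

/-- A bounded continuous vector field, defined for all times, that is uniformly Lipschitz. -/
structure IsTameField (w : ℝ → E → E) (K M : ℝ≥0) : Prop where
  continuous : Continuous (Function.uncurry w)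
  lipschitz : ∀ t, LipschitzWith K (w t)
  norm_le : ∀ t x, ‖w t x‖ ≤ M

/-- The integral curve of `w` on the whole time axis that passes through `x` at time `t`. -/
noncomputable def globalFlow (w : ℝ → E → E) (t : ℝ) (x : E) : ℝ → E :=
  Classical.epsilon fun γ : ℝ → E => γ t = x ∧ ∀ u, HasDerivAt γ (w u (γ u)) u

namespace IsTameField

variable {w : ℝ → E → E} {K M : ℝ≥0}

/-- Boundedness removes the short-time restriction of Picard–Lindelöf: during `[t - n, t + n]` a
curve cannot leave the ball of radius `M n` around `x`. Uniqueness glues the curves for different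
`n`. -/
theorem exists_curve [CompleteSpace E] (hw : IsTameField w K M) (t : ℝ) (x : E) :
    ∃ γ : ℝ → E, γ t = x ∧ ∀ u, HasDerivAt γ (w u (γ u)) u := by
  have hn : ∀ n : ℕ, ∃ γ : ℝ → E, γ t = x ∧
      ∀ u ∈ Ioo (t - n) (t + n), HasDerivAt γ (w u (γ u)) u := by
    intro n
    have ht : t ∈ Icc (t - n) (t + n) := by
      constructor <;> linarith [(Nat.cast_nonneg n : (0 : ℝ) ≤ n)]
    have hpl : IsPicardLindelof w (⟨t, ht⟩ : Icc (t - n) (t + n)) x (M * n) 0 M K := by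
      refine ⟨fun u _ => (hw.lipschitz u).lipschitzOnWith, fun y _ => ?_,
        fun u _ y _ => hw.norm_le u y, ?_⟩
      · exact (hw.continuous.comp (Continuous.prodMk_left y)).continuousOn
      · simp
    obtain ⟨γ, hγ, hd⟩ := hpl.exists_eq_forall_mem_Icc_hasDerivWithinAt₀
    exact ⟨γ, hγ, fun u hu => (hd u (Ioo_subset_Icc_self hu)).hasDerivAt (Icc_mem_nhds hu.1 hu.2)⟩
  choose γ hγ hd using hn
  have hEq : ∀ m n : ℕ, m ≤ n → EqOn (γ m) (γ n) (Ioo (t - m) (t + m)) := by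
    intro m n hmn u hu
    have hmn' : (m : ℝ) ≤ n := by exact_mod_cast hmn
    have ht : t ∈ Ioo (t - m) (t + m) := by constructor <;> linarith [hu.1, hu.2]
    refine ODE_solution_unique_of_mem_Ioo (v := w) (s := fun _ => univ) (K := K)
      (fun u _ => (hw.lipschitz u).lipschitzOnWith) ht (fun u hu => ⟨hd m u hu, mem_univ _⟩)
      (fun u hu => ⟨hd n u ⟨by linarith [hu.1], by linarith [hu.2]⟩, mem_univ _⟩)
      (by rw [hγ, hγ]) hu
  refine ⟨fun u => γ (⌈|u - t|⌉₊ + 1) u, hγ _, fun u => ?_⟩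
  -- Points within distance one of `u` use a curve of index at most `N`, which agrees there with `γ
  -- N`.
  set N := ⌈|u - t|⌉₊ + 2 with hN
  have hmem : ∀ z : ℝ, z ∈ Ioo (t - (⌈|z - t|⌉₊ + 1 : ℕ)) (t + (⌈|z - t|⌉₊ + 1 : ℕ)) := by
    intro z
    have h1 := Nat.le_ceil |z - t|
    push_cast
    constructor <;> linarith [neg_abs_le (z - t), le_abs_self (z - t)]
  have hev : (fun z => γ (⌈|z - t|⌉₊ + 1) z) =ᶠ[𝓝 u] γ N := by
    filter_upwards [Metric.ball_mem_nhds u one_pos] with z hz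
    refine hEq _ _ ?_ (hmem z)
    rw [Metric.mem_ball, Real.dist_eq] at hz
    have : ⌈|z - t|⌉₊ ≤ ⌈|u - t|⌉₊ + 1 := by
      rw [Nat.ceil_le]
      push_cast
      have h1 := Nat.le_ceil |u - t|
      have h2 : |z - t| ≤ |z - u| + |u - t| := abs_sub_le z u t
      linarith
    omega
  have huN : u ∈ Ioo (t - N) (t + N) := by
    have := hmem u
    push_cast [hN] at this ⊢
    constructor <;> linarith [this.1, this.2]
  have := (hd N u huN).congr_of_eventuallyEq hev
  rwa [← hev.self_of_nhds] at this

section Flow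

variable [CompleteSpace E] (hw : IsTameField w K M)
include hw

theorem globalFlow_self (t : ℝ) (x : E) : globalFlow w t x t = x :=
  (Classical.epsilon_spec (hw.exists_curve t x)).1

theorem hasDerivAt_globalFlow (t : ℝ) (x : E) (u : ℝ) :
    HasDerivAt (globalFlow w t x) (w u (globalFlow w t x u)) u :=
  (Classical.epsilon_spec (hw.exists_curve t x)).2 u

theorem continuous_globalFlow (t : ℝ) (x : E) : Continuous (globalFlow w t x) :=
  continuous_iff_continuousAt.2 fun u => (hw.hasDerivAt_globalFlow t x u).continuousAt

theorem isCurveOn_globalFlow (t : ℝ) (x : E) (a b : ℝ) : IsCurveOn w a b (globalFlow w t x) :=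
  ⟨(hw.continuous_globalFlow t x).continuousOn, fun u _ => hw.hasDerivAt_globalFlow t x u⟩

theorem eqOn_globalFlow {a b t : ℝ} {γ : ℝ → E} (hγ : IsCurveOn w a b γ) (ht : t ∈ Icc a b) :
    EqOn γ (globalFlow w t (γ t)) (Icc a b) :=
  hγ.eqOn (hw.isCurveOn_globalFlow t (γ t) a b) (fun u _ => (hw.lipschitz u).lipschitzOnWith)
    (fun _ _ => mem_univ _) (fun _ _ => mem_univ _) ht (hw.globalFlow_self t (γ t)).symm

theorem globalFlow_globalFlow (t t' r : ℝ) (x : E) :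
    globalFlow w t' (globalFlow w t x t') r = globalFlow w t x r :=
  (hw.eqOn_globalFlow (hw.isCurveOn_globalFlow t x (min t' r) (max t' r))
    ⟨min_le_left _ _, le_max_left _ _⟩ ⟨min_le_right _ _, le_max_right _ _⟩).symm

theorem norm_globalFlow_sub_le (t r : ℝ) (x y : E) :
    ‖globalFlow w t x r - globalFlow w t y r‖ ≤ Real.exp (K * |r - t|) * ‖x - y‖ := by
  have := (hw.isCurveOn_globalFlow t x (min t r) (max t r)).norm_sub_le
    (hw.isCurveOn_globalFlow t y (min t r) (max t r))
    (fun u _ => (hw.lipschitz u).lipschitzOnWith)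
    (fun _ _ => mem_univ _) (fun _ _ => mem_univ _) (r := r) (t := t)
    ⟨min_le_right _ _, le_max_right _ _⟩ ⟨min_le_left _ _, le_max_left _ _⟩
  rwa [hw.globalFlow_self, hw.globalFlow_self] at this

theorem norm_globalFlow_sub_self_le (t r : ℝ) (x : E) :
    ‖globalFlow w t x r - x‖ ≤ M * |r - t| := by
  have := convex_univ.norm_image_sub_le_of_norm_hasDerivWithin_le
    (fun u _ => (hw.hasDerivAt_globalFlow t x u).hasDerivWithinAt)
    (fun u _ => hw.norm_le u _) (mem_univ t) (mem_univ r)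
  rwa [hw.globalFlow_self, Real.norm_eq_abs] at this

/-- Following the flow from time `t` to `t'` displaces `x` by at most `M |t' - t|`; afterwards both
curves start at the same time. -/
theorem norm_globalFlow_sub_globalFlow_le (t t' r : ℝ) (x y : E) :
    ‖globalFlow w t x r - globalFlow w t' y r‖ ≤
      Real.exp (K * |r - t'|) * (‖x - y‖ + M * |t' - t|) := by
  rw [← hw.globalFlow_globalFlow t t' r x]
  refine (hw.norm_globalFlow_sub_le t' r _ y).trans
    (mul_le_mul_of_nonneg_left ?_ (Real.exp_pos _).le)
  calc _ ≤ ‖globalFlow w t x t' - x‖ + ‖x - y‖ := norm_sub_le_norm_sub_add_norm_sub _ _ _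
    _ ≤ _ := by linarith [hw.norm_globalFlow_sub_self_le t t' x]

theorem lipschitzWith_globalFlow (t r : ℝ) :
    LipschitzWith (Real.exp (K * |r - t|)).toNNReal (fun x => globalFlow w t x r) :=
  LipschitzWith.of_dist_le_mul fun x y => by
    rw [Real.coe_toNNReal _ (Real.exp_pos _).le, dist_eq_norm, dist_eq_norm]
    exact hw.norm_globalFlow_sub_le t r x y

theorem continuous_globalFlow_uncurry (r : ℝ) :
    Continuous fun p : ℝ × E => globalFlow w p.1 p.2 r := by
  refine continuous_iff_continuousAt.2 fun q => tendsto_iff_norm_sub_tendsto_zero.2 ?_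
  refine squeeze_zero (fun _ => norm_nonneg _)
    (fun p => hw.norm_globalFlow_sub_globalFlow_le p.1 q.1 r p.2 q.2) ?_
  have : Continuous fun p : ℝ × E =>
      Real.exp (K * |r - q.1|) * (‖p.2 - q.2‖ + M * |q.1 - p.1|) := by fun_prop
  simpa using this.tendsto q

theorem continuous_globalFlow_initial (t : ℝ) :
    Continuous fun p : ℝ × E => globalFlow w t p.2 p.1 := by
  have h := hw.continuous_globalFlow
  refine continuous_iff_continuousAt.2 fun q => tendsto_iff_norm_sub_tendsto_zero.2 ?_
  have hle : ∀ p : ℝ × E, ‖globalFlow w t p.2 p.1 - globalFlow w t q.2 q.1‖ ≤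
      Real.exp (K * |p.1 - t|) * ‖p.2 - q.2‖ +
        ‖globalFlow w t q.2 p.1 - globalFlow w t q.2 q.1‖ := fun p =>
    (norm_sub_le_norm_sub_add_norm_sub _ (globalFlow w t q.2 p.1) _).trans
      (by gcongr; exact hw.norm_globalFlow_sub_le t p.1 p.2 q.2)
  refine squeeze_zero (fun _ => norm_nonneg _) hle ?_
  have : Continuous fun p : ℝ × E => Real.exp (K * |p.1 - t|) * ‖p.2 - q.2‖ +
        ‖globalFlow w t q.2 p.1 - globalFlow w t q.2 q.1‖ := by
    have := (h t q.2).comp (continuous_fst : Continuous fun p : ℝ × E => p.1)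
    simp only [Function.comp_def] at this
    fun_prop
  simpa using this.tendsto q

/-- Differentiating the flow along a moving initial condition. -/
theorem hasDerivAt_globalFlow_initial {c : ℝ → E} {c' : E} {r : ℝ} (hc : HasDerivAt c c' r) :
    HasDerivAt (fun ρ => globalFlow w ρ (c ρ) r) (c' - w r (c r)) r := by
  -- The flow runs only from `ρ` to the nearby time `r`, so its displacement is `-(ρ - r) w(r, c r)`
  -- up to `o(ρ - r)`. No derivative of the flow in its initial point is involved.
  have hrem : HasDerivAt (fun ρ => globalFlow w ρ (c ρ) r - c ρ) (-(w r (c r))) r := by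
    rw [hasDerivAt_iff_isLittleO, Asymptotics.isLittleO_iff]
    intro ε hε
    have hcont : ContinuousAt (Function.uncurry w) (r, c r) := hw.continuous.continuousAt
    obtain ⟨δ, hδ, hball⟩ := Metric.continuousAt_iff.1 hcont ε hε
    have h1 : ∀ᶠ ρ in 𝓝 r, ‖c ρ - c r‖ < δ / 2 := by
      have := Metric.continuousAt_iff.1 hc.continuousAt (δ / 2) (by positivity)
      obtain ⟨η, hη, h⟩ := this
      filter_upwards [Metric.ball_mem_nhds r hη] with ρ hρ
      rw [← dist_eq_norm]
      exact h hρ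
    -- The factor `M + 1` covers both the time increment and the distance, at most `M |ρ - r|`, that
    -- the curve travels.
    have h2 : ∀ᶠ ρ in 𝓝 r, (M + 1) * |ρ - r| < δ / 2 := by
      have : ContinuousAt (fun ρ : ℝ => ((M : ℝ) + 1) * |ρ - r|) r := by fun_prop
      exact this.eventually_lt continuousAt_const (by simpa using hδ)
    filter_upwards [h1, h2] with ρ hρ1 hρ2
    set γ := globalFlow w ρ (c ρ) with hγ
    have hnear : ∀ u ∈ uIcc r ρ, ‖w u (γ u) - w r (c r)‖ ≤ ε := by
      intro u hu
      have hu1 : |u - ρ| ≤ |ρ - r| := by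
        rw [abs_sub_comm u ρ]
        exact abs_sub_right_of_mem_uIcc hu
      have hu2 : |u - r| ≤ |ρ - r| := abs_sub_left_of_mem_uIcc hu
      rw [← dist_eq_norm]
      refine (hball (x := (u, γ u)) ?_).le
      rw [Prod.dist_eq, max_lt_iff]
      have hM : (0 : ℝ) ≤ M := M.2
      constructor
      · rw [Real.dist_eq]
        simp only
        nlinarith [abs_nonneg (ρ - r)]
      · simp only
        rw [dist_eq_norm]
        have := hw.norm_globalFlow_sub_self_le ρ u (c ρ)
        have h3 := norm_sub_le_norm_sub_add_norm_sub (γ u) (c ρ) (c r)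
        nlinarith [abs_nonneg (ρ - r), mul_le_mul_of_nonneg_left hu1 hM]
    have hd : ∀ u ∈ uIcc r ρ, HasDerivWithinAt (fun u => γ u - u • w r (c r))
        (w u (γ u) - w r (c r)) (uIcc r ρ) u := fun u _ => by
      have := (hw.hasDerivAt_globalFlow ρ (c ρ) u).sub ((hasDerivAt_id u).smul_const (w r (c r)))
      rw [one_smul] at this
      exact this.hasDerivWithinAt
    have := (convex_uIcc r ρ).norm_image_sub_le_of_norm_hasDerivWithin_le hd hnear
      right_mem_uIcc left_mem_uIcc
    rw [norm_sub_rev ρ r] at *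
    have hself : globalFlow w r (c r) r = c r := hw.globalFlow_self r (c r)
    have hself' : γ ρ = c ρ := hw.globalFlow_self ρ (c ρ)
    rw [hself'] at this
    convert this using 2
    rw [hself]
    module
  have := hrem.add hc
  simp only [neg_add_eq_sub] at this
  convert this using 1
  ext ρ
  simp
end Flow

end IsTameField

end ODE

/-! ### Truncation of locally Lipschitz fields and a priori bounds -/

section Truncation

variable {E : Type*} [NormedAddCommGroup E] [InnerProductSpace ℝ E]

/-- The radial retraction onto the closed ball of radius `R`. -/
noncomputable def radialRetraction (R : ℝ) (x : E) : E := (R / max R ‖x‖) • x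

theorem radialRetraction_of_norm_le {R : ℝ} (hR : 0 < R) {x : E} (hx : ‖x‖ ≤ R) :
    radialRetraction R x = x := by
  rw [radialRetraction, max_eq_left hx, div_self hR.ne', one_smul]

theorem norm_radialRetraction_le_norm {R : ℝ} (hR : 0 < R) (x : E) :
    ‖radialRetraction R x‖ ≤ ‖x‖ := by
  rw [radialRetraction, norm_smul]
  refine mul_le_of_le_one_left (norm_nonneg _) ?_
  rw [Real.norm_of_nonneg (by positivity)]
  exact div_le_one_of_le₀ (le_max_left _ _) (by positivity)

theorem norm_radialRetraction_le {R : ℝ} (hR : 0 < R) (x : E) :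
    ‖radialRetraction R x‖ ≤ R := by
  rw [radialRetraction, norm_smul, Real.norm_of_nonneg (by positivity), div_mul_eq_mul_div]
  exact div_le_of_le_mul₀ (by positivity) hR.le
    (mul_le_mul_of_nonneg_left (le_max_right _ _) hR.le)

theorem lipschitzWith_radialRetraction {R : ℝ} (hR : 0 < R) :
    LipschitzWith 2 (radialRetraction R : E → E) := by
  refine LipschitzWith.of_dist_le_mul fun x y => ?_
  rw [dist_eq_norm, dist_eq_norm]
  set p := max R ‖x‖ with hp
  set q := max R ‖y‖ with hq
  have hp0 : 0 < p := lt_max_of_lt_left hR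
  have hq0 : 0 < q := lt_max_of_lt_left hR
  have h1 : radialRetraction R x - radialRetraction R y =
      (R / p) • (x - y) + ((R / p) * ((q - p) / q)) • y := by
    have : (R / p) * ((q - p) / q) = R / p - R / q := by field_simp
    rw [this, radialRetraction, radialRetraction, smul_sub, sub_smul]
    abel
  have hRp : R / p ≤ 1 := div_le_one_of_le₀ (le_max_left _ _) hp0.le
  have hRp0 : 0 ≤ R / p := by positivity
  have hpq : |q - p| ≤ ‖x - y‖ := by
    refine (abs_max_sub_max_le_max R ‖y‖ R ‖x‖).trans ?_
    rw [sub_self, abs_zero, max_eq_right (abs_nonneg _), norm_sub_rev]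
    exact abs_norm_sub_norm_le y x
  have hyq : ‖y‖ / q ≤ 1 := div_le_one_of_le₀ (le_max_right _ _) hq0.le
  rw [h1]
  refine (norm_add_le _ _).trans ?_
  rw [norm_smul, norm_smul, norm_mul, Real.norm_of_nonneg hRp0, norm_div,
    Real.norm_of_nonneg hq0.le, Real.norm_eq_abs]
  have h2 : R / p * (|q - p| / q) * ‖y‖ = (R / p) * |q - p| * (‖y‖ / q) := by ring
  rw [h2]
  have h3 : R / p * ‖x - y‖ ≤ ‖x - y‖ := mul_le_of_le_one_left (norm_nonneg _) hRp
  have h4 : R / p * |q - p| * (‖y‖ / q) ≤ ‖x - y‖ := by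
    calc _ ≤ 1 * ‖x - y‖ * 1 := by gcongr
      _ = _ := by ring
  rw [NNReal.coe_ofNat]
  linarith

/-- The field `v`, frozen outside of the time interval `[s, T]` and of the ball of radius `R`. -/
noncomputable def truncatedField (v : ℝ → E → E) (s T R : ℝ) (u : ℝ) (x : E) : E :=
  v (max s (min u T)) (radialRetraction R x)

theorem truncatedField_eq {v : ℝ → E → E} {s T R u : ℝ} (hR : 0 < R) (hu : u ∈ Icc s T) {x : E}
    (hx : ‖x‖ ≤ R) : truncatedField v s T R u x = v u x := by
  rw [truncatedField, radialRetraction_of_norm_le hR hx, min_eq_left hu.2, max_eq_right hu.1]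

/-- Continuous in time and space and locally Lipschitz in space on `(0, T]`, with linear growth
away from both ends. -/
structure IsRegularField (T : ℝ) (v : ℝ → E → E) : Prop where
  continuousOn : ContinuousOn (Function.uncurry v) (Ioc 0 T ×ˢ univ)
  lipschitz : ∀ s R : ℝ, 0 < s → ∃ K : ℝ≥0, ∀ t ∈ Icc s T,
    LipschitzOnWith K (v t) (Metric.closedBall 0 R)
  growth : ∀ s t : ℝ, 0 < s → t < T → ∃ A : ℝ, 0 ≤ A ∧ ∀ u ∈ Icc s t, ∀ x,
    ‖v u x‖ ≤ A * (1 + ‖x‖)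

namespace IsRegularField

variable {v : ℝ → E → E} {T : ℝ}

/-- Clamping time and retracting space confine the arguments of `v` to a compact set, on which it is
bounded and uniformly Lipschitz in space. -/
theorem exists_isTameField [FiniteDimensional ℝ E] (hv : IsRegularField T v) {s R : ℝ}
    (hs : 0 < s) (hsT : s ≤ T) (hR : 0 < R) :
    ∃ K M : ℝ≥0, IsTameField (truncatedField v s T R) K M := by
  have : ProperSpace E := FiniteDimensional.proper ℝ E
  obtain ⟨K, hK⟩ := hv.lipschitz s R hs
  have hclamp : ∀ u : ℝ, max s (min u T) ∈ Icc s T := fun u =>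
    ⟨le_max_left _ _, max_le hsT (min_le_right _ _)⟩
  have hball : ∀ x : E, radialRetraction R x ∈ Metric.closedBall (0 : E) R := fun x => by
    rw [mem_closedBall_zero_iff]
    exact norm_radialRetraction_le hR x
  have hcpt : IsCompact (Icc s T ×ˢ Metric.closedBall (0 : E) R) :=
    isCompact_Icc.prod (isCompact_closedBall 0 R)
  obtain ⟨M, hM⟩ := hcpt.exists_bound_of_continuousOn (hv.continuousOn.mono
    (prod_mono (fun u hu => ⟨hs.trans_le hu.1, hu.2⟩) (subset_univ _)))
  refine ⟨K * 2, M.toNNReal, ?_, fun t => ?_, fun t x => ?_⟩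
  · have h1 : Continuous fun p : ℝ × E => (max s (min p.1 T), radialRetraction R p.2) :=
      (by fun_prop : Continuous fun p : ℝ × E => max s (min p.1 T)).prodMk
        ((lipschitzWith_radialRetraction hR).continuous.comp continuous_snd)
    exact hv.continuousOn.comp_continuous h1 fun p =>
      ⟨⟨hs.trans_le (hclamp p.1).1, (hclamp p.1).2⟩, mem_univ _⟩
  · rw [← lipschitzOnWith_univ]
    exact (hK _ (hclamp t)).comp (lipschitzWith_radialRetraction hR).lipschitzOnWith
      fun x _ => hball x
  · exact (hM (_, _) ⟨hclamp t, hball x⟩).trans (Real.le_coe_toNNReal M)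

/-- The retraction does not increase norms, so the growth constant is the same for every `R`, and so
are the resulting bounds on trajectories. -/
theorem norm_truncatedField_le {A s t R : ℝ} (hR : 0 < R) (htT : t ≤ T)
    (hA : 0 ≤ A) (hv : ∀ u ∈ Icc s t, ∀ x, ‖v u x‖ ≤ A * (1 + ‖x‖)) {u : ℝ} (hu : u ∈ Icc s t)
    (x : E) : ‖truncatedField v s T R u x‖ ≤ A * (1 + ‖x‖) := by
  rw [truncatedField, min_eq_left (hu.2.trans htT), max_eq_right hu.1]
  refine (hv u hu _).trans (mul_le_mul_of_nonneg_left ?_ hA)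
  linarith [norm_radialRetraction_le_norm hR x]

theorem isCurveOn_truncatedField {s t a R : ℝ} {γ : ℝ → E} (hR : 0 < R)
    (hsa : s ≤ a) (htT : t ≤ T) (hγR : ∀ u ∈ Ioo a t, ‖γ u‖ ≤ R) :
    IsCurveOn (truncatedField v s T R) a t γ ↔ IsCurveOn v a t γ := by
  have h : ∀ u ∈ Ioo a t, truncatedField v s T R u (γ u) = v u (γ u) := fun u hu =>
    truncatedField_eq hR ⟨hsa.trans hu.1.le, hu.2.le.trans htT⟩ (hγR u hu)
  exact ⟨fun hγ => hγ.congr_field h, fun hγ => hγ.congr_field fun u hu => (h u hu).symm⟩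

theorem eqOn_of_isCurveOn (hv : IsRegularField T v) {s t : ℝ} (hs : 0 < s) (hst : s ≤ t)
    (htT : t ≤ T) {γ₁ γ₂ : ℝ → E} (h₁ : IsCurveOn v s t γ₁) (h₂ : IsCurveOn v s t γ₂)
    (heq : γ₁ t = γ₂ t) : EqOn γ₁ γ₂ (Icc s t) := by
  obtain ⟨R₁, hR₁⟩ := isCompact_Icc.exists_bound_of_continuousOn h₁.continuousOn
  obtain ⟨R₂, hR₂⟩ := isCompact_Icc.exists_bound_of_continuousOn h₂.continuousOn
  obtain ⟨K, hK⟩ := hv.lipschitz s (max R₁ R₂) hs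
  refine h₁.eqOn h₂ (K := K) (S := Metric.closedBall 0 (max R₁ R₂))
    (fun u hu => hK u ⟨hu.1.le, hu.2.le.trans htT⟩) (fun u hu => ?_) (fun u hu => ?_)
    (right_mem_Icc.2 hst) heq
  · exact mem_closedBall_zero_iff.2 ((hR₁ u (Ioo_subset_Icc_self hu)).trans (le_max_left _ _))
  · exact mem_closedBall_zero_iff.2 ((hR₂ u (Ioo_subset_Icc_self hu)).trans (le_max_right _ _))

variable [FiniteDimensional ℝ E]

/-- Trajectories of the truncated field, run backward, stay inside of a large enough ball. -/
theorem exists_norm_globalFlow_lt (hv : IsRegularField T v) {s t : ℝ} (hs : 0 < s) (hst : s ≤ t)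
    (htT : t ≤ T) (x : E) : ∃ R : ℝ, 0 < R ∧
      ∀ u ∈ Icc s t, ‖globalFlow (truncatedField v s T R) t x u‖ < R := by
  have : CompleteSpace E := FiniteDimensional.complete ℝ E
  have hsT : s ≤ T := hst.trans htT
  rcases hst.eq_or_lt with rfl | hst'
  · refine ⟨‖x‖ + 1, by positivity, fun u hu => ?_⟩
    obtain ⟨K, M, hw⟩ := hv.exists_isTameField (R := ‖x‖ + 1) hs hsT (by positivity)
    rw [Icc_self, mem_singleton_iff] at hu
    rw [hu, hw.globalFlow_self]
    linarith
  set R₁ := ‖x‖ + 1 with hR₁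
  have hR₁0 : 0 < R₁ := by positivity
  obtain ⟨K₁, M₁, hw₁⟩ := hv.exists_isTameField (R := R₁) hs hsT hR₁0
  have hM0 : (0 : ℝ) ≤ M₁ := M₁.2
  -- The growth bound may fail when `t = T`. A first backward step of length at most `δ`, which
  -- moves `x` by at most one, reaches some `t' < t`; the growth bound then acts on `[s, t']`.
  set δ : ℝ := ((M₁ : ℝ) + 1)⁻¹ with hδ
  have hδ0 : 0 < δ := by positivity
  set t' := max s (t - δ) with ht'
  have hst1 : s ≤ t' := le_max_left _ _
  have ht1t : t' < t := max_lt hst' (by linarith)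
  set γ₁ := globalFlow (truncatedField v s T R₁) t x with hγ₁
  have hb₁ : ∀ u ∈ Icc t' t, ‖γ₁ u‖ ≤ R₁ := fun u hu => by
    have h1 := hw₁.norm_globalFlow_sub_self_le t u x
    have h2 : |u - t| ≤ δ := by
      rw [abs_of_nonpos (by linarith [hu.2])]
      linarith [hu.1, le_max_right s (t - δ)]
    have h3 : (M₁ : ℝ) * |u - t| ≤ 1 := by
      calc (M₁ : ℝ) * |u - t| ≤ (M₁ + 1) * δ := by gcongr; linarith
        _ = 1 := mul_inv_cancel₀ (by positivity)
    have h4 := norm_sub_norm_le (γ₁ u) x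
    linarith
  obtain ⟨A, hA, hgrow⟩ := hv.growth s t' hs (ht1t.trans_le htT)
  set y := γ₁ t' with hy
  -- Grönwall gives `‖γ₂ u‖ ≤ 1 + ‖γ₂ u‖² ≤ R₂` with constants that do not depend on the truncation
  -- radius, so using `R₂` itself as that radius is not circular.
  set R₂ := Real.exp (3 * A * |t' - s|) * (1 + ‖y‖ ^ 2) with hR₂
  have hR₂0 : 0 < R₂ := by positivity
  obtain ⟨K₂, M₂, hw₂⟩ := hv.exists_isTameField (R := R₂) hs hsT hR₂0
  set γ₂ := globalFlow (truncatedField v s T R₂) t' y with hγ₂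
  have hb₂ : ∀ u ∈ Icc s t', ‖γ₂ u‖ ≤ R₂ := fun u hu => by
    have h1 := (hw₂.isCurveOn_globalFlow t' y s t').one_add_norm_sq_le hA
      (fun u hu => norm_truncatedField_le hR₂0 (ht1t.le.trans htT) hA hgrow
        (Ioo_subset_Icc_self hu) _) hu (right_mem_Icc.2 hst1)
    rw [hw₂.globalFlow_self] at h1
    have h2 : Real.exp (3 * A * |u - t'|) ≤ Real.exp (3 * A * |t' - s|) := by
      rw [Real.exp_le_exp, abs_of_nonpos (by linarith [hu.2]), abs_of_nonneg (by linarith)]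
      exact mul_le_mul_of_nonneg_left (by linarith [hu.1]) (by positivity)
    have h3 := mul_le_mul_of_nonneg_right h2 (by positivity : 0 ≤ 1 + ‖y‖ ^ 2)
    nlinarith [sq_nonneg (‖γ₂ u‖ - 1)]
  set R := max R₁ R₂ + 1 with hR
  have hR0 : 0 < R := by positivity
  have hR₁R : R₁ < R := (le_max_left R₁ R₂).trans_lt (lt_add_one _)
  have hR₂R : R₂ < R := (le_max_right R₁ R₂).trans_lt (lt_add_one _)
  obtain ⟨K, M, hw⟩ := hv.exists_isTameField (R := R) hs hsT hR0
  have hc₁ : IsCurveOn (truncatedField v s T R) t' t γ₁ :=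
    (isCurveOn_truncatedField hR0 hst1 htT fun u hu =>
      (hb₁ u (Ioo_subset_Icc_self hu)).trans hR₁R.le).2
    ((isCurveOn_truncatedField hR₁0 hst1 htT fun u hu => hb₁ u (Ioo_subset_Icc_self hu)).1
      (hw₁.isCurveOn_globalFlow t x t' t))
  have hc₂ : IsCurveOn (truncatedField v s T R) s t' γ₂ :=
    (isCurveOn_truncatedField hR0 le_rfl (ht1t.le.trans htT) fun u hu =>
      (hb₂ u (Ioo_subset_Icc_self hu)).trans hR₂R.le).2
    ((isCurveOn_truncatedField hR₂0 le_rfl (ht1t.le.trans htT) fun u hu =>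
      hb₂ u (Ioo_subset_Icc_self hu)).1 (hw₂.isCurveOn_globalFlow t' y s t'))
  have he₁ := hw.eqOn_globalFlow hc₁ (right_mem_Icc.2 ht1t.le)
  rw [hγ₁, hw₁.globalFlow_self, ← hγ₁] at he₁
  have he₂ := hw.eqOn_globalFlow hc₂ (right_mem_Icc.2 hst1)
  rw [hγ₂, hw₂.globalFlow_self, ← hγ₂] at he₂
  refine ⟨R, hR0, fun u hu => ?_⟩
  rcases le_total t' u with htu | htu
  · rw [← he₁ ⟨htu, hu.2⟩]
    exact (hb₁ u ⟨htu, hu.2⟩).trans_lt hR₁R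
  · rw [← hw.globalFlow_globalFlow t t', ← he₁ (left_mem_Icc.2 ht1t.le), ← he₂ ⟨hu.1, htu⟩]
    exact (hb₂ u ⟨hu.1, htu⟩).trans_lt hR₂R

end IsRegularField

end Truncation

/-! ### The flow map between positive times -/

section Flow

variable {D : ℕ} {v : ℝ → Space D → Space D} {T : ℝ}

theorem IsSolution.self {t s : ℝ} {x : Space D} {γ : ℝ → Space D} (h : IsSolution v t s x γ) :
    γ t = x := by
  rw [h.2 t left_mem_uIcc, intervalIntegral.integral_same, add_zero]

theorem IsSolution.mono {t s r : ℝ} {x : Space D} {γ : ℝ → Space D} (h : IsSolution v t s x γ)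
    (hr : r ∈ uIcc t s) : IsSolution v t r x γ :=
  ⟨h.1.mono_set (uIcc_subset_uIcc_left hr), fun u hu => h.2 u (uIcc_subset_uIcc_left hr hu)⟩

theorem IsSolution.continuousOn {t s : ℝ} {x : Space D} {γ : ℝ → Space D}
    (h : IsSolution v t s x γ) : ContinuousOn γ (uIcc t s) :=
  (continuousOn_const.add (intervalIntegral.continuousOn_primitive_interval' h.1
    left_mem_uIcc)).congr h.2

namespace IsRegularField

variable (hv : IsRegularField T v) {s t : ℝ} {x : Space D} {γ : ℝ → Space D}
include hv

theorem continuousOn_comp (hs : 0 < s) (htT : t ≤ T) (hγ : ContinuousOn γ (Icc s t)) :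
    ContinuousOn (fun u => v u (γ u)) (Icc s t) :=
  hv.continuousOn.comp (continuousOn_id.prodMk hγ)
    fun _ hu => ⟨⟨hs.trans_le hu.1, hu.2.trans htT⟩, mem_univ _⟩

/-- Away from time zero the drift is continuous along any continuous curve, so the fundamental
theorem of calculus applies in both directions. -/
theorem isSolution_iff (hs : 0 < s) (hst : s ≤ t) (htT : t ≤ T) :
    IsSolution v t s x γ ↔ IsCurveOn v s t γ ∧ γ t = x := by
  constructor
  · intro h
    have hcont : ContinuousOn γ (Icc s t) := uIcc_of_ge hst ▸ h.continuousOn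
    have hc := hv.continuousOn_comp hs htT hcont
    refine ⟨⟨hcont, fun u hu => ?_⟩, h.self⟩
    have hnhds : Icc s t ∈ 𝓝 u := Icc_mem_nhds hu.1 hu.2
    have h1 : HasDerivAt (fun r => x + ∫ z in t..r, v z (γ z)) (v u (γ u)) u := by
      refine (intervalIntegral.integral_hasDerivAt_right ?_ ?_ (hc.continuousAt hnhds)).const_add x
      · exact (h.mono (uIcc_of_ge hst ▸ Ioo_subset_Icc_self hu)).1
      · exact ⟨Icc s t, hnhds, hc.aestronglyMeasurable measurableSet_Icc⟩
    refine h1.congr_of_eventuallyEq ?_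
    filter_upwards [hnhds] with r hr
    exact h.2 r (uIcc_of_ge hst ▸ hr)
  · rintro ⟨h, hx⟩
    have hc := hv.continuousOn_comp hs htT h.continuousOn
    have hint : ∀ r ∈ Icc s t, IntervalIntegrable (fun u => v u (γ u)) volume r t := fun r hr =>
      (hc.mono (Icc_subset_Icc_left hr.1)).intervalIntegrable_of_Icc hr.2
    refine ⟨(hint s (left_mem_Icc.2 hst)).symm, fun r hr => ?_⟩
    rw [uIcc_of_ge hst] at hr
    have h2 := intervalIntegral.integral_eq_sub_of_hasDerivAt_of_le hr.2
      (h.mono hr.1 le_rfl).continuousOn (h.mono hr.1 le_rfl).hasDerivAt (hint r hr)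
    rw [intervalIntegral.integral_symm, h2, hx]
    abel

/-- Uniqueness makes the choice of a solution inside `flowMap` immaterial. -/
theorem flowMap_eq_of_isCurveOn (hs : 0 < s) (hst : s ≤ t) (htT : t ≤ T)
    (hγ : IsCurveOn v s t γ) : flowMap v t s (γ t) = γ s := by
  have hex : ∃ γ', IsSolution v t s (γ t) γ' := ⟨γ, (hv.isSolution_iff hs hst htT).2 ⟨hγ, rfl⟩⟩
  rw [flowMap, dif_pos hex]
  obtain ⟨h1, h2⟩ := (hv.isSolution_iff hs hst htT).1 hex.choose_spec
  exact hv.eqOn_of_isCurveOn hs hst htT h1 hγ h2 (left_mem_Icc.2 hst)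

theorem flowMap_eq_globalFlow (hs : 0 < s) (htT : t ≤ T) {R : ℝ} (hR : 0 < R)
    (hγ : ∀ u ∈ Icc s t, ‖globalFlow (truncatedField v s T R) t x u‖ ≤ R) {r : ℝ}
    (hr : r ∈ Icc s t) :
    flowMap v t r x = globalFlow (truncatedField v s T R) t x r := by
  have hst := hr.1.trans hr.2
  obtain ⟨K, M, hw⟩ := hv.exists_isTameField hs (hst.trans htT) hR
  have hc := (isCurveOn_truncatedField hR hr.1 htT fun u hu =>
    hγ u ⟨hr.1.trans hu.1.le, hu.2.le⟩).1 (hw.isCurveOn_globalFlow t x r t)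
  have := hv.flowMap_eq_of_isCurveOn (hs.trans_le hr.1) hr.2 htT hc
  rwa [hw.globalFlow_self] at this

/-- The threshold `R₀` depends on `x`, so truncated flows converge to the true one only pointwise as
`R → ∞`; this suffices for dominated convergence. -/
theorem exists_forall_flowMap_eq_globalFlow (hs : 0 < s) (hst : s ≤ t) (htT : t ≤ T)
    (x : Space D) : ∃ R₀ : ℝ, 0 < R₀ ∧ ∀ R ≥ R₀, ∀ r ∈ Icc s t,
      flowMap v t r x = globalFlow (truncatedField v s T R) t x r := by
  obtain ⟨R₀, hR₀, hlt⟩ := hv.exists_norm_globalFlow_lt hs hst htT x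
  obtain ⟨K₀, M₀, hw₀⟩ := hv.exists_isTameField hs (hst.trans htT) hR₀
  refine ⟨R₀, hR₀, fun R hR r hr => ?_⟩
  have hR0 := hR₀.trans_le hR
  obtain ⟨K, M, hw⟩ := hv.exists_isTameField hs (hst.trans htT) hR0
  have hc : IsCurveOn (truncatedField v s T R) s t (globalFlow (truncatedField v s T R₀) t x) :=
    (isCurveOn_truncatedField hR0 le_rfl htT fun u hu =>
      (hlt u (Ioo_subset_Icc_self hu)).le.trans hR).2
    ((isCurveOn_truncatedField hR₀ le_rfl htT fun u hu => (hlt u (Ioo_subset_Icc_self hu)).le).1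
      (hw₀.isCurveOn_globalFlow t x s t))
  have he := hw.eqOn_globalFlow hc (right_mem_Icc.2 hst)
  rw [hw₀.globalFlow_self] at he
  rw [← he hr]
  exact hv.flowMap_eq_globalFlow hs htT hR₀ (fun u hu => (hlt u hu).le) hr

/-- Near `(t, x)` the flow is that of one truncated field. -/
theorem exists_eventually_flowMap_eq_globalFlow (hs : 0 < s) (hst : s ≤ t) (htT : t ≤ T)
    (x : Space D) : ∃ R : ℝ, 0 < R ∧ ∀ᶠ p : ℝ × Space D in 𝓝 (t, x), p.1 ≤ t →
      ∀ r ∈ Icc s p.1, flowMap v p.1 r p.2 = globalFlow (truncatedField v s T R) p.1 p.2 r := by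
  obtain ⟨R₀, hR₀, hlt⟩ := hv.exists_norm_globalFlow_lt hs hst htT x
  obtain ⟨K, M, hw⟩ := hv.exists_isTameField hs (hst.trans htT) hR₀
  obtain ⟨u₀, hu₀, hmax⟩ := isCompact_Icc.exists_isMaxOn (nonempty_Icc.2 hst)
    (hw.continuous_globalFlow t x).norm.continuousOn
  -- The gap between the compact trajectory and the sphere of radius `R₀`; trajectories from nearby
  -- data stay within `η` of it.
  set η := R₀ - ‖globalFlow (truncatedField v s T R₀) t x u₀‖ with hη
  have hη0 : 0 < η := sub_pos.2 (hlt u₀ hu₀)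
  refine ⟨R₀, hR₀, ?_⟩
  have hcont : Continuous fun p : ℝ × Space D =>
      Real.exp (K * (t - s)) * (‖p.2 - x‖ + M * |t - p.1|) := by fun_prop
  have hev := (hcont.tendsto (t, x)).eventually_lt (tendsto_const_nhds (x := η)) (by simpa using hη0)
  filter_upwards [hev] with p hp hpt r hr
  refine hv.flowMap_eq_globalFlow hs (hpt.trans htT) hR₀ (fun u hu => ?_) hr
  have hut : u ∈ Icc s t := ⟨hu.1, hu.2.trans hpt⟩
  have h1 := hw.norm_globalFlow_sub_globalFlow_le p.1 t u p.2 x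
  have h2 : Real.exp (K * |u - t|) ≤ Real.exp (K * (t - s)) := by
    rw [Real.exp_le_exp, abs_of_nonpos (by linarith [hut.2])]
    exact mul_le_mul_of_nonneg_left (by linarith [hut.1]) K.2
  have h3 := mul_le_mul_of_nonneg_right h2 (by positivity : 0 ≤ ‖p.2 - x‖ + M * |t - p.1|)
  have h4 := norm_sub_norm_le (globalFlow (truncatedField v s T R₀) p.1 p.2 u)
    (globalFlow (truncatedField v s T R₀) t x u)
  have h5 : ‖globalFlow (truncatedField v s T R₀) t x u‖ ≤
    ‖globalFlow (truncatedField v s T R₀) t x u₀‖ := hmax hut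
  linarith

theorem isCurveOn_flowMap (hs : 0 < s) (hst : s ≤ t) (htT : t ≤ T) (x : Space D) :
    IsCurveOn v s t (fun r => flowMap v t r x) ∧ flowMap v t t x = x := by
  obtain ⟨R, hR, hlt⟩ := hv.exists_norm_globalFlow_lt hs hst htT x
  obtain ⟨K, M, hw⟩ := hv.exists_isTameField hs (hst.trans htT) hR
  have hc : IsCurveOn v s t (globalFlow (truncatedField v s T R) t x) :=
    (isCurveOn_truncatedField hR le_rfl htT fun u hu => (hlt u (Ioo_subset_Icc_self hu)).le).1
      (hw.isCurveOn_globalFlow t x s t)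
  have heq : EqOn (fun r => flowMap v t r x) (globalFlow (truncatedField v s T R) t x) (Icc s t) :=
    fun r hr => hv.flowMap_eq_globalFlow hs htT hR (fun u hu => (hlt u hu).le) hr
  refine ⟨⟨hc.continuousOn.congr heq, fun u hu => ?_⟩, ?_⟩
  · have hev : (fun r => flowMap v t r x) =ᶠ[𝓝 u] globalFlow (truncatedField v s T R) t x :=
      heq.eventuallyEq_of_mem (Icc_mem_nhds hu.1 hu.2)
    have := (hc.hasDerivAt u hu).congr_of_eventuallyEq hev
    rwa [← hev.self_of_nhds] at this
  · exact (heq (right_mem_Icc.2 hst)).trans (hw.globalFlow_self t x)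

theorem flowMap_flowMap {r : ℝ} (hr : 0 < r) (hrs : r ≤ s) (hst : s ≤ t) (htT : t ≤ T)
    (x : Space D) : flowMap v s r (flowMap v t s x) = flowMap v t r x :=
  hv.flowMap_eq_of_isCurveOn hr hrs (hst.trans htT)
    ((hv.isCurveOn_flowMap hr (hrs.trans hst) htT x).1.mono le_rfl hst)

theorem continuous_flowMap (hs : 0 < s) (hst : s ≤ t) (htT : t ≤ T) :
    Continuous (flowMap v t s) := by
  refine continuous_iff_continuousAt.2 fun x => ?_
  obtain ⟨R, hR, hev⟩ := hv.exists_eventually_flowMap_eq_globalFlow hs hst htT x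
  obtain ⟨K, M, hw⟩ := hv.exists_isTameField hs (hst.trans htT) hR
  have hev' : flowMap v t s =ᶠ[𝓝 x] fun y => globalFlow (truncatedField v s T R) t y s := by
    have := (Continuous.prodMk_right t : Continuous fun y : Space D => (t, y)).tendsto x
    filter_upwards [this.eventually hev] with y hy
    exact hy le_rfl s (left_mem_Icc.2 hst)
  exact ((hw.lipschitzWith_globalFlow t s).continuous.continuousAt).congr hev'.symm

/-- Joint continuity in the final time and the point supplies the measurability needed for Tonelli's
theorem. -/
theorem continuousOn_flowMap_uncurry (htT : t ≤ T) :
    ContinuousOn (fun p : ℝ × Space D => flowMap v t p.1 p.2) (Ioc 0 t ×ˢ univ) := by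
  rintro ⟨r, x⟩ ⟨hr, -⟩
  have hs : 0 < r / 2 := half_pos hr.1
  have hst : r / 2 ≤ t := by linarith [hr.1, hr.2]
  obtain ⟨R, hR, hev⟩ := hv.exists_eventually_flowMap_eq_globalFlow hs hst htT x
  obtain ⟨K, M, hw⟩ := hv.exists_isTameField hs (hst.trans htT) hR
  have hcont := ((hw.continuous_globalFlow_initial t).tendsto (r, x)).mono_left
    (nhdsWithin_le_nhds (s := Ioc 0 t ×ˢ univ))
  have hev' : ∀ᶠ p : ℝ × Space D in 𝓝 (r, x), ∀ z ∈ Icc (r / 2) t,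
      flowMap v t z p.2 = globalFlow (truncatedField v (r / 2) T R) t p.2 z := by
    have : Continuous fun p : ℝ × Space D => (t, p.2) := by fun_prop
    filter_upwards [(this.tendsto (r, x)).eventually hev] with p hp
    exact hp le_rfl
  have hlt : ∀ᶠ p : ℝ × Space D in 𝓝 (r, x), r / 2 < p.1 :=
    continuousAt_fst.eventually_const_lt (by simpa using by linarith [hr.1])
  have heq : (fun p : ℝ × Space D => globalFlow (truncatedField v (r / 2) T R) t p.2 p.1)
      =ᶠ[𝓝[Ioc 0 t ×ˢ univ] (r, x)] fun p : ℝ × Space D => flowMap v t p.1 p.2 := by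
    filter_upwards [nhdsWithin_le_nhds hev', nhdsWithin_le_nhds hlt, self_mem_nhdsWithin]
      with p hp hlt hmem
    exact (hp p.1 ⟨hlt.le, hmem.1.2⟩).symm
  have hval : globalFlow (truncatedField v (r / 2) T R) t x r = flowMap v t r x :=
    (hev'.self_of_nhds r ⟨by linarith [hr.1], hr.2⟩).symm
  have := hcont.congr' heq
  rw [hval] at this
  exact this

/-- The flow is continuous in the initial time and point, from the left. -/
theorem tendsto_flowMap_initial (hs : 0 < s) (hst : s < t) (htT : t ≤ T) (x : Space D) :
    Tendsto (fun p : ℝ × Space D => flowMap v p.1 s p.2) (𝓝[Iic t ×ˢ univ] (t, x))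
      (𝓝 (flowMap v t s x)) := by
  obtain ⟨R, hR, hev⟩ := hv.exists_eventually_flowMap_eq_globalFlow hs hst.le htT x
  obtain ⟨K, M, hw⟩ := hv.exists_isTameField hs (hst.le.trans htT) hR
  have hcont := ((hw.continuous_globalFlow_uncurry s).tendsto (t, x)).mono_left
    (nhdsWithin_le_nhds (s := Iic t ×ˢ univ))
  have hlt : ∀ᶠ p : ℝ × Space D in 𝓝 (t, x), s < p.1 :=
    continuousAt_fst.eventually_const_lt (by simpa using hst)
  have hval : globalFlow (truncatedField v s T R) t x s = flowMap v t s x :=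
    (hev.self_of_nhds le_rfl s (left_mem_Icc.2 hst.le)).symm
  simp only [hval] at hcont
  refine hcont.congr' ?_
  filter_upwards [nhdsWithin_le_nhds hev, nhdsWithin_le_nhds hlt, self_mem_nhdsWithin]
    with p hp hlt hmem
  exact (hp hmem.1 s ⟨le_rfl, hlt.le⟩).symm

end IsRegularField

end Flow

/-! ### Regularity of the probability-flow drift -/

namespace IsNoiseSchedule

variable {D : ℕ} {T : ℝ} {α σ : ℝ → ℝ} (hsched : IsNoiseSchedule T α σ)
include hsched

theorem continuousOn_derivWithin_signal : ContinuousOn (derivWithin α (Ioc 0 T)) (Ioc 0 T) :=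
  hsched.contDiffOn_signal.continuousOn_derivWithin (uniqueDiffOn_Ioc 0 T) le_rfl

theorem continuousOn_derivWithin_noise : ContinuousOn (derivWithin σ (Ioc 0 T)) (Ioc 0 T) :=
  hsched.contDiffOn_noise.continuousOn_derivWithin (uniqueDiffOn_Ioc 0 T) le_rfl

theorem hasDerivAt_signal {t : ℝ} (ht : t ∈ Ioo 0 T) :
    HasDerivAt α (derivWithin α (Ioc 0 T) t) t :=
  ((hsched.contDiffOn_signal.differentiableOn one_ne_zero) t
    (Ioo_subset_Ioc_self ht)).hasDerivWithinAt.hasDerivAt (Ioc_mem_nhds ht.1 ht.2)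

theorem hasDerivAt_noise {t : ℝ} (ht : t ∈ Ioo 0 T) :
    HasDerivAt σ (derivWithin σ (Ioc 0 T) t) t :=
  ((hsched.contDiffOn_noise.differentiableOn one_ne_zero) t
    (Ioo_subset_Ioc_self ht)).hasDerivWithinAt.hasDerivAt (Ioc_mem_nhds ht.1 ht.2)

theorem continuousOn_noiseCoeff :
    ContinuousOn (fun t => derivWithin σ (Ioc 0 T) t / σ t) (Ioc 0 T) :=
  hsched.continuousOn_derivWithin_noise.div hsched.contDiffOn_noise.continuousOn
    fun t ht => (hsched.noise_pos t ht).ne'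

theorem continuousOn_signalCoeff :
    ContinuousOn (fun t => derivWithin α (Ioc 0 T) t -
      α t * (derivWithin σ (Ioc 0 T) t / σ t)) (Ioc 0 T) :=
  hsched.continuousOn_derivWithin_signal.sub
    (hsched.contDiffOn_signal.continuousOn.mul hsched.continuousOn_noiseCoeff)

theorem continuousOn_schedule :
    ContinuousOn (fun p : ℝ × Space D => (α p.1, σ p.1, p.2)) (Ioc 0 T ×ˢ univ) := by
  have h1 : ContinuousOn (fun p : ℝ × Space D => α p.1) (Ioc 0 T ×ˢ univ) :=
    hsched.contDiffOn_signal.continuousOn.comp continuousOn_fst fun p hp => hp.1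
  have h2 : ContinuousOn (fun p : ℝ × Space D => σ p.1) (Ioc 0 T ×ˢ univ) :=
    hsched.contDiffOn_noise.continuousOn.comp continuousOn_fst fun p hp => hp.1
  exact h1.prodMk (h2.prodMk continuousOn_snd)

variable {pdata : Measure (Space D)} [IsProbabilityMeasure pdata]

theorem continuousOn_evidence :
    ContinuousOn (fun p : ℝ × Space D => evidence pdata (α p.1) (σ p.1) p.2)
      (Ioc 0 T ×ˢ univ) := fun p hp =>
  ContinuousAt.comp_continuousWithinAt (f := fun p : ℝ × Space D => (α p.1, σ p.1, p.2))
    (g := fun q : ℝ × ℝ × Space D => evidence pdata q.1 q.2.1 q.2.2)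
    (continuousAt_evidence (hsched.noise_pos p.1 hp.1).ne') (hsched.continuousOn_schedule p hp)

theorem continuousOn_denoiser (hmoment : Integrable (fun x : Space D => x) pdata) :
    ContinuousOn (fun p : ℝ × Space D => denoiser pdata α σ p.1 p.2) (Ioc 0 T ×ˢ univ) := by
  simp only [denoiser_eq]
  refine (hsched.continuousOn_evidence.inv₀ fun p _ => (evidence_pos p.2).ne').smul fun p hp => ?_
  exact ContinuousAt.comp_continuousWithinAt (f := fun p : ℝ × Space D => (α p.1, σ p.1, p.2))
    (g := fun q : ℝ × ℝ × Space D => weightedMean pdata q.1 q.2.1 q.2.2)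
    (continuousAt_weightedMean hmoment (hsched.noise_pos p.1 hp.1).ne')
    (hsched.continuousOn_schedule p hp)

/-- The drift of the probability-flow ODE is regular on `(0, T]`. -/
theorem isRegularField_velocity (hmoment : Integrable (fun x : Space D => x) pdata) :
    IsRegularField T (velocity pdata T α σ) := by
  have hsub : ∀ {s : ℝ}, 0 < s → Icc s T ⊆ Ioc 0 T := fun hs u hu => ⟨hs.trans_le hu.1, hu.2⟩
  set m := ∫ x₀, ‖x₀‖ ∂pdata with hm
  have hm0 : 0 ≤ m := integral_nonneg fun _ => norm_nonneg _
  refine ⟨?_, fun s R hs => ?_, fun s t hs ht => ?_⟩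
  · have hfst : ∀ {g : ℝ → ℝ}, ContinuousOn g (Ioc 0 T) →
        ContinuousOn (fun p : ℝ × Space D => g p.1) (Ioc 0 T ×ˢ univ) := fun hg =>
      hg.comp continuousOn_fst fun p hp => hp.1
    exact ((hfst hsched.continuousOn_signalCoeff).smul (hsched.continuousOn_denoiser hmoment)).add
      ((hfst hsched.continuousOn_noiseCoeff).smul continuousOn_snd)
  · obtain ⟨A, hA⟩ := isCompact_Icc.exists_bound_of_continuousOn
      (hsched.continuousOn_signalCoeff.mono (hsub hs))
    obtain ⟨B, hB⟩ := isCompact_Icc.exists_bound_of_continuousOn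
      (hsched.continuousOn_noiseCoeff.mono (hsub hs))
    obtain ⟨S, hS⟩ := isCompact_Icc.exists_bound_of_continuousOn
      ((hsched.contDiffOn_noise.continuousOn.inv₀ fun t ht =>
        (hsched.noise_pos t ht).ne').mono (hsub hs))
    -- The evidence is continuous and positive, hence bounded below by some `z > 0` on the compact
    -- set.
    obtain ⟨z, hz0, hz⟩ := (isCompact_Icc.prod (isCompact_closedBall (0 : Space D) R)).exists_forall_le'
      ((hsched.continuousOn_evidence (pdata := pdata)).mono (prod_mono (hsub hs) (subset_univ _)))
      (a := 0) fun p _ => evidence_pos p.2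
    refine ⟨(A * (m * S * (z⁻¹ + z⁻¹ * z⁻¹)) + B).toNNReal, fun t ht =>
      LipschitzOnWith.of_dist_le_mul fun x hx y hy => ?_⟩
    have hσ := hsched.noise_pos t (hsub hs ht)
    have h1 := norm_denoiser_sub_le (pdata := pdata) (α := α) (σ := σ) hmoment hσ hz0
      (hz (t, x) ⟨ht, hx⟩) (hz (t, y) ⟨ht, hy⟩)
    have hA' := hA t ht
    have hB' := hB t ht
    have hS' := hS t ht
    rw [Pi.inv_apply, norm_inv, Real.norm_of_nonneg hσ.le] at hS'
    have hA0 := (norm_nonneg _).trans hA'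
    have hS0 : 0 ≤ S := (inv_nonneg.2 hσ.le).trans hS'
    rw [dist_eq_norm, dist_eq_norm, velocity, velocity, add_sub_add_comm, ← smul_sub, ← smul_sub]
    refine (norm_add_le _ _).trans ?_
    rw [norm_smul, norm_smul]
    have hle : A * (m * S * (z⁻¹ + z⁻¹ * z⁻¹)) + B ≤
      ((A * (m * S * (z⁻¹ + z⁻¹ * z⁻¹)) + B).toNNReal : ℝ) := Real.le_coe_toNNReal _
    refine le_trans ?_ (mul_le_mul_of_nonneg_right hle (norm_nonneg _))
    rw [add_mul]
    refine add_le_add ?_ (mul_le_mul_of_nonneg_right hB' (norm_nonneg _))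
    rw [mul_assoc]
    refine mul_le_mul hA' (h1.trans ?_) (norm_nonneg _) hA0
    rw [← hm]
    gcongr
  · have hsub' : Icc s t ⊆ Ioc 0 T := fun u hu => ⟨hs.trans_le hu.1, hu.2.trans ht.le⟩
    have hpos : ∀ u ∈ Icc s t, 0 < α u := fun u hu =>
      hsched.signal_pos u ⟨hs.trans_le hu.1, hu.2.trans_lt ht⟩
    obtain ⟨A, hA⟩ := isCompact_Icc.exists_bound_of_continuousOn
      (hsched.continuousOn_signalCoeff.mono hsub')
    obtain ⟨B, hB⟩ := isCompact_Icc.exists_bound_of_continuousOn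
      (hsched.continuousOn_noiseCoeff.mono hsub')
    -- The growth constant contains `1 / α`, which may blow up at `T`; this is why the interval
    -- stops before `T`.
    obtain ⟨S, hS⟩ := isCompact_Icc.exists_bound_of_continuousOn
      ((hsched.contDiffOn_signal.continuousOn.mono hsub').inv₀ fun u hu => (hpos u hu).ne')
    rcases lt_or_ge t s with hts | hst
    · exact ⟨0, le_rfl, fun u hu => absurd (hu.1.trans hu.2) (not_le.2 hts)⟩
    have hA0 := (norm_nonneg _).trans (hA s (left_mem_Icc.2 hst))
    have hB0 := (norm_nonneg _).trans (hB s (left_mem_Icc.2 hst))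
    have hS0 := (norm_nonneg _).trans (hS s (left_mem_Icc.2 hst))
    refine ⟨A * (2 * S + m) + B, by positivity, fun u hu x => ?_⟩
    have h1 := norm_denoiser_le (σ := σ) hmoment (hpos u hu) (hsched.noise_pos u (hsub' hu)) x
    have hS' := hS u hu
    rw [Pi.inv_apply, norm_inv, Real.norm_of_nonneg (hpos u hu).le] at hS'
    have h2 : ‖denoiser pdata α σ u x‖ ≤ (2 * S + m) * (1 + ‖x‖) := by
      have := mul_le_mul_of_nonneg_right hS' (norm_nonneg x)
      nlinarith [norm_nonneg x, mul_nonneg hm0 (norm_nonneg x)]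
    rw [velocity]
    refine (norm_add_le _ _).trans ?_
    rw [norm_smul, norm_smul, add_mul, mul_assoc]
    refine add_le_add (mul_le_mul (hA u hu) h2 (norm_nonneg _) hA0) ?_
    exact mul_le_mul (hB u hu) (by linarith) (norm_nonneg _) hB0

end IsNoiseSchedule

/-! ### The drift as a conditional expectation -/

section Conditional

variable {D : ℕ} {pdata : Measure (Space D)} {α σ : ℝ → ℝ} {T : ℝ}

theorem continuous_interpolant (a b : ℝ) :
    Continuous fun z : Space D × Space D => a • z.1 + b • z.2 := by fun_prop

instance isProbabilityMeasure_marginal [IsProbabilityMeasure pdata] (t : ℝ) :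
    IsProbabilityMeasure (marginal pdata α σ t) :=
  Measure.isProbabilityMeasure_map (continuous_interpolant _ _).aemeasurable

theorem integrable_fst_prod_stdGaussian (hmoment : Integrable (fun x : Space D => x) pdata) :
    Integrable (fun z : Space D × Space D => z.1) (pdata.prod (stdGaussian (Space D))) :=
  hmoment.comp_fst _

theorem integrable_snd_prod_stdGaussian [IsFiniteMeasure pdata] :
    Integrable (fun z : Space D × Space D => z.2) (pdata.prod (stdGaussian (Space D))) :=
  (IsGaussian.integrable_id (μ := stdGaussian (Space D))).comp_snd _

/-- The velocity of the interpolant `α x₀ + σ ε`, as a function of `x₀` and of its position `x`. -/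
noncomputable def interpolantVelocity (T : ℝ) (α σ : ℝ → ℝ) (t : ℝ) (x₀ x : Space D) : Space D :=
  (derivWithin α (Ioc 0 T) t - α t * (derivWithin σ (Ioc 0 T) t / σ t)) • x₀
    + (derivWithin σ (Ioc 0 T) t / σ t) • x

theorem interpolantVelocity_apply {t : ℝ} (hσ : σ t ≠ 0) (x₀ e : Space D) :
    interpolantVelocity T α σ t x₀ (α t • x₀ + σ t • e) =
      derivWithin α (Ioc 0 T) t • x₀ + derivWithin σ (Ioc 0 T) t • e := by
  rw [interpolantVelocity, smul_add, smul_smul, smul_smul, div_mul_cancel₀ _ hσ, sub_smul,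
    mul_comm (α t)]
  abel

theorem continuous_interpolantVelocity (t : ℝ) :
    Continuous fun z : Space D × Space D => interpolantVelocity T α σ t z.1 z.2 := by
  unfold interpolantVelocity
  fun_prop

/-- The interpolant's velocity is affine in `x₀`, so averaging it over the posterior replaces `x₀`
by the denoiser. The unnormalized form matches the joint density of `(x₀, x_t)`. -/
theorem integral_likelihood_smul_interpolantVelocity [IsProbabilityMeasure pdata]
    (hmoment : Integrable (fun x : Space D => x) pdata) (t : ℝ) (x : Space D) :
    Integrable (fun x₀ => likelihood (α t) (σ t) x x₀ • interpolantVelocity T α σ t x₀ x) pdata ∧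
    ∫ x₀, likelihood (α t) (σ t) x x₀ • interpolantVelocity T α σ t x₀ x ∂pdata =
      evidence pdata (α t) (σ t) x • velocity pdata T α σ t x := by
  set A := derivWithin α (Ioc 0 T) t - α t * (derivWithin σ (Ioc 0 T) t / σ t) with hA
  set B := derivWithin σ (Ioc 0 T) t / σ t with hB
  have h1 : Integrable (fun x₀ => A • likelihood (α t) (σ t) x x₀ • x₀) pdata :=
    (hmoment.likelihood_smul x).smul A
  have h2 := (integrable_likelihood (a := α t) (b := σ t) (pdata := pdata) x).smul_const (B • x)
  have heq : (fun x₀ => likelihood (α t) (σ t) x x₀ • interpolantVelocity T α σ t x₀ x) =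
      fun x₀ => A • likelihood (α t) (σ t) x x₀ • x₀ + likelihood (α t) (σ t) x x₀ • (B • x) := by
    ext1 x₀
    rw [interpolantVelocity, ← hA, ← hB, smul_add, smul_comm A]
  have hZ := evidence_pos (pdata := pdata) (a := α t) (b := σ t) x
  rw [heq]
  refine ⟨h1.add h2, ?_⟩
  rw [integral_add h1 h2, integral_smul, integral_smul_const, velocity, ← hA, ← hB, smul_add,
    denoiser_eq, smul_comm A, smul_inv_smul₀ hZ.ne']
  rfl

/-- Integration against the joint law of `x₀` and `x_t`, with the conditional law of `x₀` given
`x_t` carried out first. -/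
theorem integral_eq_of_integral_likelihood_eq [IsProbabilityMeasure pdata] {a b : ℝ} (hb : b ≠ 0)
    {F : Space D × Space D → ℝ} {G : Space D → ℝ}
    (hF : Measurable F) (hG : Measurable G)
    (hFi : Integrable (fun z : Space D × Space D => F (z.1, a • z.1 + b • z.2))
      (pdata.prod (stdGaussian (Space D))))
    (hGi : Integrable (fun z : Space D × Space D => G (a • z.1 + b • z.2))
      (pdata.prod (stdGaussian (Space D))))
    (h : ∀ x, ∫ x₀, likelihood a b x x₀ * F (x₀, x) ∂pdata = evidence pdata a b x * G x) :
    ∫ z, F (z.1, a • z.1 + b • z.2) ∂(pdata.prod (stdGaussian (Space D))) =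
      ∫ z, G (a • z.1 + b • z.2) ∂(pdata.prod (stdGaussian (Space D))) := by
  obtain ⟨c, hc, hmap⟩ := map_prod_stdGaussian_eq_withDensity pdata a hb
  have hT : Measurable fun z : Space D × Space D => (z.1, a • z.1 + b • z.2) := by fun_prop
  have hlik : Measurable fun z : Space D × Space D => c * likelihood a b z.2 z.1 :=
    ((continuous_likelihood.comp continuous_swap).measurable).const_mul c
  have key : ∀ H : Space D × Space D → ℝ, Measurable H →
      Integrable (fun z : Space D × Space D => H (z.1, a • z.1 + b • z.2))
        (pdata.prod (stdGaussian (Space D))) →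
      ∫ z, H (z.1, a • z.1 + b • z.2) ∂(pdata.prod (stdGaussian (Space D))) =
        ∫ x, ∫ x₀, c * (likelihood a b x x₀ * H (x₀, x)) ∂pdata := by
    intro H hH hHi
    have hHi' : Integrable H ((pdata.prod (stdGaussian (Space D))).map
        fun z : Space D × Space D => (z.1, a • z.1 + b • z.2)) :=
      (integrable_map_measure hH.aestronglyMeasurable hT.aemeasurable).2 hHi
    have h1 := integral_map hT.aemeasurable (hH.aestronglyMeasurable
      (μ := (pdata.prod (stdGaussian (Space D))).map
        fun z : Space D × Space D => (z.1, a • z.1 + b • z.2)))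
    rw [← h1, hmap]
    rw [hmap, integrable_withDensity_iff_integrable_smul' hlik.ennreal_ofReal
      (.of_forall fun _ => ENNReal.ofReal_lt_top)] at hHi'
    rw [integral_withDensity_eq_integral_toReal_smul hlik.ennreal_ofReal
      (.of_forall fun _ => ENNReal.ofReal_lt_top), integral_prod_symm _ hHi']
    refine integral_congr_ae (.of_forall fun x => integral_congr_ae (.of_forall fun x₀ => ?_))
    simp only [smul_eq_mul]
    rw [ENNReal.toReal_ofReal (mul_nonneg hc.le (likelihood_pos _ _).le), mul_assoc]
  rw [key F hF hFi, key (fun z => G z.2) (hG.comp measurable_snd) hGi]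
  refine integral_congr_ae (.of_forall fun x => ?_)
  simp only
  rw [integral_const_mul, integral_const_mul, h, integral_mul_const]
  rfl

/-- Jensen's inequality: a conditional expectation is no larger in mean than `α' x₀ + σ' ε`. The
division by `σ` has disappeared, so the bound stays integrable in `t` down to zero. -/
theorem lintegral_enorm_velocity_le [IsProbabilityMeasure pdata]
    (hmoment : Integrable (fun x : Space D => x) pdata) {t : ℝ} (hσ : σ t ≠ 0)
    (hv : Measurable (velocity pdata T α σ t)) :
    ∫⁻ x, ‖velocity pdata T α σ t x‖ₑ ∂(marginal pdata α σ t) ≤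
      ‖derivWithin α (Ioc 0 T) t‖ₑ * ∫⁻ x, ‖x‖ₑ ∂pdata +
        ‖derivWithin σ (Ioc 0 T) t‖ₑ * ∫⁻ x, ‖x‖ₑ ∂(stdGaussian (Space D)) := by
  obtain ⟨c, hc, hmap⟩ := map_prod_stdGaussian_eq_withDensity pdata (α t) hσ
  have hT : Measurable fun z : Space D × Space D => (z.1, α t • z.1 + σ t • z.2) := by fun_prop
  have hlik : Measurable fun z : Space D × Space D => likelihood (α t) (σ t) z.2 z.1 :=
    (continuous_likelihood.comp continuous_swap).measurable
  have hden : Measurable fun z : Space D × Space D =>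
      ENNReal.ofReal (c * likelihood (α t) (σ t) z.2 z.1) := by fun_prop
  have key : ∀ H : Space D × Space D → ℝ≥0∞, Measurable H →
      ∫⁻ z, H (z.1, α t • z.1 + σ t • z.2) ∂(pdata.prod (stdGaussian (Space D))) =
        ENNReal.ofReal c * ∫⁻ x, ∫⁻ x₀, ENNReal.ofReal (likelihood (α t) (σ t) x x₀) * H (x₀, x)
          ∂pdata := by
    intro H hH
    have hm : Measurable fun z : Space D × Space D =>
      ENNReal.ofReal (likelihood (α t) (σ t) z.2 z.1) * H z := hlik.ennreal_ofReal.mul hH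
    have h1 := lintegral_map (μ := pdata.prod (stdGaussian (Space D))) hH hT
    rw [← h1, hmap, lintegral_withDensity_eq_lintegral_mul _ hden hH,
      lintegral_prod_symm _ (hden.mul hH).aemeasurable,
      ← lintegral_const_mul _ hm.lintegral_prod_left]
    refine lintegral_congr fun x => ?_
    have hmx : Measurable fun x₀ => ENNReal.ofReal (likelihood (α t) (σ t) x x₀) * H (x₀, x) :=
      (measurable_likelihood x).ennreal_ofReal.mul (hH.comp (by fun_prop))
    rw [← lintegral_const_mul _ hmx]
    refine lintegral_congr fun x₀ => ?_
    rw [Pi.mul_apply, ENNReal.ofReal_mul hc.le, mul_assoc]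
  have hξ : Measurable fun z : Space D × Space D => ‖interpolantVelocity T α σ t z.1 z.2‖ₑ :=
    (continuous_interpolantVelocity t).measurable.enorm
  have hle : ∫⁻ z, ‖velocity pdata T α σ t (α t • z.1 + σ t • z.2)‖ₑ
        ∂(pdata.prod (stdGaussian (Space D))) ≤
      ∫⁻ z, ‖interpolantVelocity T α σ t z.1 (α t • z.1 + σ t • z.2)‖ₑ
        ∂(pdata.prod (stdGaussian (Space D))) := by
    have e1 := key (fun z => ‖velocity pdata T α σ t z.2‖ₑ) (hv.comp measurable_snd).enorm
    have e2 := key (fun z => ‖interpolantVelocity T α σ t z.1 z.2‖ₑ) hξ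
    simp only at e1 e2
    rw [e1, e2]
    refine mul_le_mul_right (lintegral_mono fun x => ?_) _
    obtain ⟨h1, h2⟩ := integral_likelihood_smul_interpolantVelocity (T := T) (α := α) (σ := σ)
      hmoment t x
    have h3 := enorm_integral_le_lintegral_enorm (μ := pdata)
      fun x₀ => likelihood (α t) (σ t) x x₀ • interpolantVelocity T α σ t x₀ x
    rw [h2, enorm_smul] at h3
    have h4 : ∀ x₀, ‖likelihood (α t) (σ t) x x₀ • interpolantVelocity T α σ t x₀ x‖ₑ =
        ENNReal.ofReal (likelihood (α t) (σ t) x x₀) * ‖interpolantVelocity T α σ t x₀ x‖ₑ :=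
      fun x₀ => by rw [enorm_smul, Real.enorm_of_nonneg (likelihood_pos _ _).le]
    simp only [h4] at h3
    rw [lintegral_mul_const _ (measurable_likelihood x).ennreal_ofReal,
      ← ofReal_integral_eq_lintegral_ofReal (integrable_likelihood x)
        (.of_forall fun x₀ => (likelihood_pos _ _).le)]
    rwa [Real.enorm_of_nonneg (evidence_pos x).le] at h3
  rw [marginal, lintegral_map hv.enorm (continuous_interpolant _ _).measurable]
  refine hle.trans ?_
  have h5 : ∀ z : Space D × Space D,
      ‖interpolantVelocity T α σ t z.1 (α t • z.1 + σ t • z.2)‖ₑ ≤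
        ‖derivWithin α (Ioc 0 T) t‖ₑ * ‖z.1‖ₑ + ‖derivWithin σ (Ioc 0 T) t‖ₑ * ‖z.2‖ₑ := fun z => by
    rw [interpolantVelocity_apply hσ, ← enorm_smul, ← enorm_smul]
    exact enorm_add_le _ _
  refine (lintegral_mono h5).trans (le_of_eq ?_)
  rw [lintegral_add_left (by fun_prop), lintegral_const_mul _ (by fun_prop),
    lintegral_const_mul _ (by fun_prop)]
  congr 2
  · rw [lintegral_prod _ (by fun_prop)]
    simp
  · rw [lintegral_prod _ (by fun_prop)]
    simp

/-- The drift is the conditional expectation of the velocity of the interpolant. -/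
theorem integral_clm_interpolantVelocity [IsProbabilityMeasure pdata]
    (hmoment : Integrable (fun x : Space D => x) pdata) {t : ℝ} (hσ : σ t ≠ 0)
    (hv : Measurable (velocity pdata T α σ t)) {l : Space D → Space D →L[ℝ] ℝ}
    (hl : Measurable l) {C : ℝ} (hC : ∀ x, ‖l x‖ ≤ C) :
    Integrable (fun z : Space D × Space D => l (α t • z.1 + σ t • z.2)
      (velocity pdata T α σ t (α t • z.1 + σ t • z.2))) (pdata.prod (stdGaussian (Space D))) ∧
    Integrable (fun z : Space D × Space D => l (α t • z.1 + σ t • z.2)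
      (derivWithin α (Ioc 0 T) t • z.1 + derivWithin σ (Ioc 0 T) t • z.2))
      (pdata.prod (stdGaussian (Space D))) ∧
    ∫ z, l (α t • z.1 + σ t • z.2)
      (derivWithin α (Ioc 0 T) t • z.1 + derivWithin σ (Ioc 0 T) t • z.2)
      ∂(pdata.prod (stdGaussian (Space D))) =
    ∫ z, l (α t • z.1 + σ t • z.2) (velocity pdata T α σ t (α t • z.1 + σ t • z.2))
      ∂(pdata.prod (stdGaussian (Space D))) := by
  have happ : ∀ {X : Type} [MeasurableSpace X] {f : X → Space D →L[ℝ] ℝ} {g : X → Space D},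
      Measurable f → Measurable g → Measurable fun x => f x (g x) := fun hf hg =>
    (isBoundedBilinearMap_apply (𝕜 := ℝ) (E := Space D) (F := ℝ)).continuous.measurable.comp
      (hf.prodMk hg)
  have hx : Measurable fun z : Space D × Space D => α t • z.1 + σ t • z.2 :=
    (continuous_interpolant _ _).measurable
  have hbdd : ∀ {g : Space D × Space D → Space D},
      Integrable g (pdata.prod (stdGaussian (Space D))) → Measurable g →
      Integrable (fun z => l (α t • z.1 + σ t • z.2) (g z))
        (pdata.prod (stdGaussian (Space D))) := by
    intro g hg hgm
    refine (hg.norm.const_mul C).mono' (happ (hl.comp hx) hgm).aestronglyMeasurable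
      (.of_forall fun z => ?_)
    exact (ContinuousLinearMap.le_opNorm _ _).trans
      (mul_le_mul_of_nonneg_right (hC _) (norm_nonneg _))
  have hfst := integrable_fst_prod_stdGaussian hmoment
  have hsnd := integrable_snd_prod_stdGaussian (pdata := pdata)
  have hvi : Integrable (fun z : Space D × Space D =>
      velocity pdata T α σ t (α t • z.1 + σ t • z.2)) (pdata.prod (stdGaussian (Space D))) := by
    have h1 : Integrable (velocity pdata T α σ t) (marginal pdata α σ t) := by
      refine ⟨hv.aestronglyMeasurable, (lintegral_enorm_velocity_le hmoment hσ hv).trans_lt ?_⟩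
      refine ENNReal.add_lt_top.2 ⟨ENNReal.mul_lt_top enorm_lt_top ?_,
        ENNReal.mul_lt_top enorm_lt_top ?_⟩
      · exact hmoment.2
      · exact (IsGaussian.integrable_id (μ := stdGaussian (Space D))).2
    exact h1.comp_measurable hx
  have hξi := (hfst.smul (derivWithin α (Ioc 0 T) t)).add (hsnd.smul (derivWithin σ (Ioc 0 T) t))
  refine ⟨hbdd hvi (hv.comp hx), hbdd hξi (by fun_prop), ?_⟩
  have hF : Measurable fun z : Space D × Space D =>
      l z.2 (interpolantVelocity T α σ t z.1 z.2) :=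
    happ (hl.comp measurable_snd) (continuous_interpolantVelocity t).measurable
  have hξi' := hbdd hξi (by fun_prop)
  simp only [Pi.add_apply, Pi.smul_apply, ← interpolantVelocity_apply hσ] at hξi'
  have key := integral_eq_of_integral_likelihood_eq (pdata := pdata) (a := α t) hσ
    (F := fun z => l z.2 (interpolantVelocity T α σ t z.1 z.2))
    (G := fun x => l x (velocity pdata T α σ t x)) hF (happ hl hv) hξi'
    (hbdd hvi (hv.comp hx)) fun x => by
      obtain ⟨h1, h2⟩ := integral_likelihood_smul_interpolantVelocity (T := T) (α := α) (σ := σ)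
        hmoment t x
      have h3 := (l x).integral_comp_comm h1
      rw [h2] at h3
      simpa only [map_smul, smul_eq_mul] using h3
  simpa only [interpolantVelocity_apply hσ] using key

/-- The diffused marginals are absolutely continuous. -/
theorem ae_interpolant_of_ae_volume [IsProbabilityMeasure pdata] {a b : ℝ} (hb : b ≠ 0)
    {p : Space D → Prop} (hp : ∀ᵐ x, p x) :
    ∀ᵐ z ∂(pdata.prod (stdGaussian (Space D))), p (a • z.1 + b • z.2) := by
  obtain ⟨c, hc, hmap⟩ := map_prod_stdGaussian_eq_withDensity pdata a hb
  have h1 : ∀ᵐ z ∂(pdata.prod (volume : Measure (Space D))), p z.2 :=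
    Measure.quasiMeasurePreserving_snd.ae hp
  have h2 : ∀ᵐ z ∂(pdata.prod (volume : Measure (Space D))).withDensity
      fun z => ENNReal.ofReal (c * likelihood a b z.2 z.1), p z.2 := (withDensity_absolutelyContinuous (pdata.prod (volume : Measure (Space D)))
    fun z => ENNReal.ofReal (c * likelihood a b z.2 z.1)).ae_le h1
  rw [← hmap] at h2
  exact ae_of_ae_map (f := fun z : Space D × Space D => (z.1, a • z.1 + b • z.2)) (by fun_prop) h2

end Conditional

/-! ### Transport of the marginals between positive times -/

/-- Thickened indicators of a compact set are Lipschitz with bounded support and converge to its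
indicator; inner regularity passes from compact to measurable sets. -/
theorem MeasureTheory.Measure.ext_of_forall_lipschitz {D : ℕ} {μ ν : Measure (Space D)}
    [IsFiniteMeasure μ] [IsFiniteMeasure ν]
    (h : ∀ (C : ℝ≥0) (ρ : ℝ) (φ : Space D → ℝ), LipschitzWith C φ → (∀ x, ‖φ x‖ ≤ 1) →
      (∀ x, ρ < ‖x‖ → φ x = 0) → ∫ x, φ x ∂μ = ∫ x, φ x ∂ν) : μ = ν := by
  have hcpt : ∀ S : Set (Space D), IsCompact S → μ S = ν S := by
    intro S hS
    have hδ : ∀ n : ℕ, (0 : ℝ) < 1 / ((n : ℝ) + 1) := fun n => Nat.one_div_pos_of_nat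
    have hlim := tendsto_one_div_add_atTop_nhds_zero_nat (𝕜 := ℝ)
    have h1 := tendsto_integral_thickenedIndicator_of_isClosed μ hS.isClosed hδ hlim
    have h2 := tendsto_integral_thickenedIndicator_of_isClosed ν hS.isClosed hδ hlim
    obtain ⟨ρ, hρ⟩ := hS.isBounded.exists_norm_le
    have heq : ∀ n : ℕ, ∫ x, (thickenedIndicator (hδ n) S x : ℝ) ∂μ =
        ∫ x, (thickenedIndicator (hδ n) S x : ℝ) ∂ν := fun n => by
      refine h _ (ρ + 1) _ (lipschitzWith_thickenedIndicator (hδ n) S) (fun x => ?_)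
        fun x hx => ?_
      · rw [NNReal.norm_eq]
        exact_mod_cast thickenedIndicator_le_one (hδ n) S x
      · rw [thickenedIndicator_zero (hδ n) S]
        · rfl
        · rw [Metric.mem_thickening_iff]
          rintro ⟨y, hy, hxy⟩
          have h3 := hρ y hy
          have h4 := norm_sub_norm_le x y
          rw [dist_eq_norm] at hxy
          have h5 : 1 / ((n : ℝ) + 1) ≤ 1 := by
            rw [div_le_one (by positivity)]
            linarith [(Nat.cast_nonneg n : (0 : ℝ) ≤ n)]
          linarith
    simp only [heq] at h1
    have := tendsto_nhds_unique h1 h2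
    exact (measureReal_eq_measureReal_iff).1 this
  ext A hA
  rw [hA.measure_eq_iSup_isCompact_of_ne_top (measure_ne_top μ A),
    hA.measure_eq_iSup_isCompact_of_ne_top (measure_ne_top ν A)]
  exact iSup_congr fun S => iSup_congr fun _ => iSup_congr fun hS => hcpt S hS

section Pushforward

variable {D : ℕ} {pdata : Measure (Space D)} {α σ : ℝ → ℝ} {T : ℝ}

theorem integral_marginal (φ : Space D → ℝ) (hφ : Continuous φ) (t : ℝ) :
    ∫ x, φ x ∂(marginal pdata α σ t) =
      ∫ z, φ (α t • z.1 + σ t • z.2) ∂(pdata.prod (stdGaussian (Space D))) :=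
  integral_map (continuous_interpolant _ _).aemeasurable hφ.aestronglyMeasurable

variable [IsProbabilityMeasure pdata]

namespace IsNoiseSchedule

variable (hsched : IsNoiseSchedule T α σ)
include hsched

/-- Duality form of the continuity equation: a compactly supported test function that is
transported by the flow of the truncated drift has a constant mean along the marginals. -/
theorem exists_forall_integral_globalFlow_eq (hmoment : Integrable (fun x : Space D => x) pdata)
    {s t : ℝ} (hs : 0 < s) (hst : s ≤ t) (htT : t < T) {C : ℝ≥0} {ρ : ℝ} {φ : Space D → ℝ}
    (hφ : LipschitzWith C φ) (hφ1 : ∀ x, ‖φ x‖ ≤ 1) (hφρ : ∀ x, ρ < ‖x‖ → φ x = 0) :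
    ∃ R₀ : ℝ, 0 < R₀ ∧ ∀ R ≥ R₀,
      ∫ x, φ (globalFlow (truncatedField (velocity pdata T α σ) (s / 2) T R) t x s)
        ∂(marginal pdata α σ t) = ∫ x, φ x ∂(marginal pdata α σ s) := by
  have hv := hsched.isRegularField_velocity hmoment
  set v := velocity pdata T α σ with hvdef
  -- The margins `s' < s` and `t < t' < T` make every time in `[s, t]` interior, so that two-sided
  -- derivatives exist there.
  set s' := s / 2 with hs'
  set t' := (t + T) / 2 with ht'
  have hs'0 : 0 < s' := half_pos hs
  have hs's : s' < s := half_lt_self hs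
  have htt' : t < t' := by linarith
  have ht'T : t' < T := by linarith
  have hsT : s' ≤ T := by linarith
  obtain ⟨A, hA, hgrow⟩ := hv.growth s' t' hs'0 ht'T
  -- A truncated trajectory that meets the ball of radius `ρ` at time `s` has norm at most `R₀`
  -- throughout `[s', t']`, whatever `R` is. For `R ≥ R₀` the transported test function thus
  -- vanishes wherever the truncation alters the drift.
  set R₀ := Real.exp (3 * A * T) * (1 + ρ ^ 2) with hR₀
  have hR₀0 : 0 < R₀ := by positivity
  refine ⟨R₀, hR₀0, fun R hR => ?_⟩
  have hR0 := hR₀0.trans_le hR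
  obtain ⟨K, M, hw⟩ := hv.exists_isTameField hs'0 hsT hR0
  set w := truncatedField v s' T R with hwdef
  set P := pdata.prod (stdGaussian (Space D)) with hP
  have hsub : ∀ {r : ℝ}, r ∈ Icc s' t' → r ∈ Ioo 0 T := fun hr =>
    ⟨hs'0.trans_le hr.1, hr.2.trans_lt ht'T⟩
  have hst'' : Icc s t ⊆ Ioo s' t' := fun r hr => ⟨hs's.trans_le hr.1, hr.2.trans_lt htt'⟩
  have habs : ∀ {r : ℝ}, r ∈ Icc s' t' → |s - r| ≤ T := fun hr => by
    rw [abs_le]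
    constructor <;> linarith [(hsub hr).1, (hsub hr).2]
  have hsupp : ∀ r ∈ Icc s' t', ∀ x, R < ‖x‖ → φ (globalFlow w r x s) = 0 := by
    intro r hr x hx
    refine hφρ _ (not_le.1 fun hle => ?_)
    have hs_mem : s ∈ Icc s' t' := ⟨hs's.le, (hst.trans_lt htt').le⟩
    have h1 := (hw.isCurveOn_globalFlow r x s' t').one_add_norm_sq_le hA
      (fun u hu => IsRegularField.norm_truncatedField_le hR0 ht'T.le hA hgrow
        (Ioo_subset_Icc_self hu) _) hr hs_mem
    rw [hw.globalFlow_self] at h1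
    have h2 : Real.exp (3 * A * |r - s|) * (1 + ‖globalFlow w r x s‖ ^ 2) ≤ R₀ := by
      rw [hR₀]
      have := habs hr
      rw [abs_sub_comm] at this
      gcongr
    nlinarith [sq_nonneg (‖x‖ - 1)]
  -- Lipschitz bound for the interpolant.
  obtain ⟨B₁, hB₁⟩ := isCompact_Icc.exists_bound_of_continuousOn
    (hsched.continuousOn_derivWithin_signal.mono fun r (hr : r ∈ Icc s' t') =>
      Ioo_subset_Ioc_self (hsub hr))
  obtain ⟨B₂, hB₂⟩ := isCompact_Icc.exists_bound_of_continuousOn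
    (hsched.continuousOn_derivWithin_noise.mono fun r (hr : r ∈ Icc s' t') =>
      Ioo_subset_Ioc_self (hsub hr))
  have hαL : ∀ r ∈ Icc s' t', ∀ r' ∈ Icc s' t', ‖α r - α r'‖ ≤ B₁ * ‖r - r'‖ :=
    fun r hr r' hr' => (convex_Icc s' t').norm_image_sub_le_of_norm_hasDerivWithin_le
      (fun u hu => (hsched.hasDerivAt_signal (hsub hu)).hasDerivWithinAt) hB₁ hr' hr
  have hσL : ∀ r ∈ Icc s' t', ∀ r' ∈ Icc s' t', ‖σ r - σ r'‖ ≤ B₂ * ‖r - r'‖ :=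
    fun r hr r' hr' => (convex_Icc s' t').norm_image_sub_le_of_norm_hasDerivWithin_le
      (fun u hu => (hsched.hasDerivAt_noise (hsub hu)).hasDerivWithinAt) hB₂ hr' hr
  set X : ℝ → Space D × Space D → Space D := fun r z => α r • z.1 + σ r • z.2 with hX
  have hXL : ∀ z, ∀ r ∈ Icc s' t', ∀ r' ∈ Icc s' t',
      ‖X r z - X r' z‖ ≤ (B₁ * ‖z.1‖ + B₂ * ‖z.2‖) * ‖r - r'‖ := by
    intro z r hr r' hr'
    rw [hX]
    simp only
    rw [add_sub_add_comm, ← sub_smul, ← sub_smul]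
    refine (norm_add_le _ _).trans ?_
    rw [norm_smul, norm_smul]
    have h1 := mul_le_mul_of_nonneg_right (hαL r hr r' hr') (norm_nonneg z.1)
    have h2 := mul_le_mul_of_nonneg_right (hσL r hr r' hr') (norm_nonneg z.2)
    linarith
  set F : ℝ → Space D × Space D → ℝ := fun r z => φ (globalFlow w r (X r z) s) with hF
  set bound : Space D × Space D → ℝ := fun z =>
    C * (Real.exp (K * T) * (B₁ * ‖z.1‖ + B₂ * ‖z.2‖ + M)) with hbound
  have hFL : ∀ z, LipschitzOnWith (Real.nnabs (bound z)) (F · z) (Ioo s' t') := by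
    intro z
    refine LipschitzOnWith.of_dist_le_mul fun r hr r' hr' => ?_
    replace hr := Ioo_subset_Icc_self hr
    replace hr' := Ioo_subset_Icc_self hr'
    rw [Real.coe_nnabs]
    refine le_trans ?_ (mul_le_mul_of_nonneg_right (le_abs_self _) dist_nonneg)
    refine (hφ.dist_le_mul _ _).trans ?_
    rw [hbound, mul_assoc]
    refine mul_le_mul_of_nonneg_left ?_ C.2
    rw [dist_eq_norm, Real.dist_eq]
    refine (hw.norm_globalFlow_sub_globalFlow_le _ _ _ _ _).trans ?_
    have h1 := hXL z r hr r' hr'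
    rw [Real.norm_eq_abs] at h1
    have h2 := habs hr'
    rw [mul_assoc]
    have h3 : ‖X r z - X r' z‖ + M * |r' - r| ≤ (B₁ * ‖z.1‖ + B₂ * ‖z.2‖ + M) * |r - r'| := by
      rw [abs_sub_comm r' r]
      linarith
    gcongr
  have hXc : ∀ r, Continuous (X r) := fun r => continuous_interpolant _ _
  have hFc : ∀ r, Continuous (F r) := fun r =>
    hφ.continuous.comp ((hw.lipschitzWith_globalFlow r s).continuous.comp (hXc r))
  have hbi : Integrable bound P :=
    (((((integrable_fst_prod_stdGaussian hmoment).norm.const_mul B₁).add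
      (integrable_snd_prod_stdGaussian.norm.const_mul B₂)).add
        (integrable_const (M : ℝ))).const_mul _).const_mul _
  have hderiv : ∀ r ∈ Icc s t, HasDerivAt (fun r => ∫ z, F r z ∂P) 0 r := by
    intro r hr
    have hr1 := hst'' hr
    have hr2 := Ioo_subset_Icc_self hr1
    have hr3 := hsub hr2
    have hσr : σ r ≠ 0 := (hsched.noise_pos r (Ioo_subset_Ioc_self hr3)).ne'
    set g : Space D → ℝ := fun x => φ (globalFlow w r x s) with hg
    have hgL := hφ.comp (hw.lipschitzWith_globalFlow r s)
    set l : Space D → Space D →L[ℝ] ℝ := fderiv ℝ g with hl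
    have hlm : Measurable l := measurable_fderiv ℝ g
    have hlC : ∀ x, ‖l x‖ ≤ _ := fun x => norm_fderiv_le_of_lipschitz ℝ hgL
    have hvm : Measurable (v r) := (hv.continuousOn.comp_continuous
      (Continuous.prodMk_right r) fun x => ⟨Ioo_subset_Ioc_self hr3, mem_univ _⟩).measurable
    -- Outside the ball of radius `R` the two drifts may differ, but `g` vanishes locally there and
    -- its derivative kills both.
    have hlw : ∀ x, l x (w r x) = l x (v r x) := by
      intro x
      rcases le_or_gt ‖x‖ R with hx | hx
      · rw [hwdef, truncatedField_eq hR0 ⟨hr1.1.le, hr3.2.le⟩ hx]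
      · have hev : g =ᶠ[𝓝 x] fun _ => 0 := by
          filter_upwards [continuous_norm.continuousAt.eventually_const_lt hx] with y hy
          exact hsupp r hr2 y hy
        have : l x = 0 := by rw [hl, hev.fderiv_eq, fderiv_fun_const, Pi.zero_apply]
        rw [this, zero_apply, zero_apply]
    obtain ⟨hi1, hi2, hint⟩ := integral_clm_interpolantVelocity hmoment hσr hvm hlm hlC
    set Y : Space D × Space D → Space D := fun z =>
      derivWithin α (Ioc 0 T) r • z.1 + derivWithin σ (Ioc 0 T) r • z.2 with hY
    -- Rademacher's theorem makes `g` differentiable Lebesgue-almost everywhere, and the law of `X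
    -- r` is absolutely continuous. The interpolant contributes `Y`, the moving starting time
    -- contributes `-w`.
    have hdiff : ∀ᵐ z ∂P, HasDerivAt (F · z) (l (X r z) (Y z) - l (X r z) (v r (X r z))) r := by
      filter_upwards [ae_interpolant_of_ae_volume (a := α r) hσr hgL.ae_differentiableAt] with z hz
      have hc : HasDerivAt (fun ρ => X ρ z) (Y z) r :=
        ((hsched.hasDerivAt_signal hr3).smul_const z.1).add
          ((hsched.hasDerivAt_noise hr3).smul_const z.2)
      -- By the semigroup law `F ρ z` is `g` applied to the flow from `ρ` to `r` of `X ρ z`, so only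
      -- the flow to the current time `r` has to be differentiated.
      have h1 := hw.hasDerivAt_globalFlow_initial hc
      have h2 : HasFDerivAt g (l (X r z)) (globalFlow w r (X r z) r) := by
        rw [hw.globalFlow_self]
        exact DifferentiableAt.hasFDerivAt hz
      have h3 := HasFDerivAt.comp_hasDerivAt (f := fun ρ => globalFlow w ρ (X ρ z) r) r h2 h1
      rw [map_sub, hlw] at h3
      refine h3.congr_of_eventuallyEq (.of_forall fun ρ' => ?_)
      simp only [hF, hg, Function.comp]
      rw [hw.globalFlow_globalFlow]
    have hmain := hasDerivAt_integral_of_dominated_loc_of_lip (μ := P) (F := F) (bound := bound)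
      (Ioo_mem_nhds hr1.1 hr1.2) (.of_forall fun r => (hFc r).aestronglyMeasurable)
      (.of_bound (hFc r).aestronglyMeasurable 1 (.of_forall fun z => hφ1 _))
      (hi2.sub hi1).aestronglyMeasurable (.of_forall hFL) hbi hdiff
    have hzero : ∫ z, (l (X r z) (Y z) - l (X r z) (v r (X r z))) ∂P = 0 := by
      rw [integral_sub hi2 hi1, hint, sub_self]
    rw [← hzero]
    exact hmain.2
  have hconst := constant_of_has_deriv_right_zero (f := fun r => ∫ z, F r z ∂P)
    (fun r hr => (hderiv r hr).continuousAt.continuousWithinAt)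
    (fun r hr => (hderiv r (Ico_subset_Icc_self hr)).hasDerivWithinAt) t (right_mem_Icc.2 hst)
  have e1 := integral_marginal (pdata := pdata) (α := α) (σ := σ) _
    (hφ.continuous.comp (hw.lipschitzWith_globalFlow t s).continuous) t
  have e2 := integral_marginal (pdata := pdata) (α := α) (σ := σ) _ hφ.continuous s
  simp only [Function.comp] at e1
  rw [e1, e2]
  refine hconst.trans (integral_congr_ae (.of_forall fun z => ?_))
  simp only [hF]
  rw [hw.globalFlow_self]

/-- The truncation is removed by `R → ∞`: one side of the truncated identity converges by dominated
convergence, the other does not involve `R`. -/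
theorem integral_flowMap_eq_of_lt (hmoment : Integrable (fun x : Space D => x) pdata)
    {s t : ℝ} (hs : 0 < s) (hst : s ≤ t) (htT : t < T) {C : ℝ≥0} {ρ : ℝ} {φ : Space D → ℝ}
    (hφ : LipschitzWith C φ) (hφ1 : ∀ x, ‖φ x‖ ≤ 1) (hφρ : ∀ x, ρ < ‖x‖ → φ x = 0) :
    ∫ x, φ (flowMap (velocity pdata T α σ) t s x) ∂(marginal pdata α σ t) =
      ∫ x, φ x ∂(marginal pdata α σ s) := by
  have hv := hsched.isRegularField_velocity hmoment
  set v := velocity pdata T α σ with hvdef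
  have hs2 : 0 < s / 2 := half_pos hs
  have hs2s : s / 2 ≤ s := half_le_self hs.le
  obtain ⟨R₀, hR₀, hconst⟩ :=
    hsched.exists_forall_integral_globalFlow_eq hmoment hs hst htT hφ hφ1 hφρ
  have hev : ∀ᶠ R : ℝ in atTop,
      ∫ x, φ (globalFlow (truncatedField v (s / 2) T R) t x s) ∂(marginal pdata α σ t) =
        ∫ x, φ x ∂(marginal pdata α σ s) := by
    filter_upwards [eventually_ge_atTop R₀] with R hR
    exact hconst R hR
  have hlim : Tendsto (fun R : ℝ =>
      ∫ x, φ (globalFlow (truncatedField v (s / 2) T R) t x s) ∂(marginal pdata α σ t)) atTop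
      (𝓝 (∫ x, φ (flowMap v t s x) ∂(marginal pdata α σ t))) := by
    refine tendsto_integral_filter_of_dominated_convergence (fun _ => 1) ?_
      (.of_forall fun R => .of_forall fun x => hφ1 _) (integrable_const _)
      (.of_forall fun x => ?_)
    · filter_upwards [eventually_gt_atTop 0] with R hR
      obtain ⟨K, M, hw⟩ := hv.exists_isTameField hs2 (by linarith : s / 2 ≤ T) hR
      exact (hφ.continuous.comp
        (hw.lipschitzWith_globalFlow t s).continuous).aestronglyMeasurable
    · obtain ⟨R₁, hR₁, h⟩ := hv.exists_forall_flowMap_eq_globalFlow hs2 (hs2s.trans hst) htT.le x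
      refine tendsto_const_nhds.congr' ?_
      filter_upwards [eventually_ge_atTop R₁] with R hR
      rw [h R hR s ⟨hs2s, hst⟩]
  exact tendsto_nhds_unique hlim (tendsto_const_nhds.congr' (hev.mono fun R h => h.symm))

/-- The flow of the probability-flow ODE transports the marginals, for positive times. -/
theorem map_flowMap_marginal (hmoment : Integrable (fun x : Space D => x) pdata)
    {s t : ℝ} (hs : 0 < s) (hst : s ≤ t) (htT : t ≤ T) :
    (marginal pdata α σ t).map (flowMap (velocity pdata T α σ) t s) = marginal pdata α σ s := by
  have hv := hsched.isRegularField_velocity hmoment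
  have hcont := hv.continuous_flowMap hs hst htT
  have := Measure.isProbabilityMeasure_map (μ := marginal pdata α σ t) hcont.aemeasurable
  refine Measure.ext_of_forall_lipschitz fun C ρ φ hφ hφ1 hφρ => ?_
  rw [integral_map hcont.aemeasurable hφ.continuous.aestronglyMeasurable]
  rcases htT.lt_or_eq with hlt | rfl
  · exact hsched.integral_flowMap_eq_of_lt hmoment hs hst hlt hφ hφ1 hφρ
  rcases hst.eq_or_lt with rfl | hst'
  · have : ∀ x, flowMap (velocity pdata s α σ) s s x = x := fun x =>
      (hv.isCurveOn_flowMap hs le_rfl le_rfl x).2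
    simp only [this]
  -- Now `t` is the terminal time, where the growth bound is unavailable, and the identity for `r <
  -- t` is passed to the limit. All marginals are realized on one probability space so that
  -- dominated convergence applies.
  have hlim : Tendsto (fun r => ∫ z, φ (flowMap (velocity pdata t α σ) r s
      (α r • z.1 + σ r • z.2)) ∂(pdata.prod (stdGaussian (Space D)))) (𝓝[<] t)
      (𝓝 (∫ z, φ (flowMap (velocity pdata t α σ) t s (α t • z.1 + σ t • z.2))
        ∂(pdata.prod (stdGaussian (Space D))))) := by
    refine tendsto_integral_filter_of_dominated_convergence (fun _ => 1) ?_
      (.of_forall fun R => .of_forall fun x => hφ1 _) (integrable_const _)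
      (.of_forall fun z => ?_)
    · filter_upwards [self_mem_nhdsWithin, nhdsWithin_le_nhds (lt_mem_nhds hst')] with r hr hsr
      have h1 := (hv.continuous_flowMap hs hsr.le (le_of_lt hr)).comp
        (continuous_interpolant (α r) (σ r))
      exact Continuous.aestronglyMeasurable (hφ.continuous.comp h1)
    · have hmem : t ∈ Icc 0 t := ⟨(hs.trans hst').le, le_rfl⟩
      have hle : 𝓝[<] t ≤ 𝓝[Icc 0 t] t := by
        rw [← nhdsWithin_Ioo_eq_nhdsLT (hs.trans hst')]
        exact nhdsWithin_mono _ Ioo_subset_Icc_self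
      have hp : Tendsto (fun r => (r, α r • z.1 + σ r • z.2)) (𝓝[<] t)
          (𝓝[Iic t ×ˢ univ] (t, α t • z.1 + σ t • z.2)) := by
        rw [nhdsWithin_prod_eq, nhdsWithin_univ]
        exact Tendsto.prodMk (nhdsWithin_mono _ Iio_subset_Iic_self)
          ((((hsched.continuousOn_signal t hmem).mono_left hle).smul_const z.1).add
            (((hsched.continuousOn_noise t hmem).mono_left hle).smul_const z.2))
      have h1 := (hv.tendsto_flowMap_initial hs hst' le_rfl (α t • z.1 + σ t • z.2)).comp hp
      exact (hφ.continuous.tendsto _).comp h1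
  have e1 := integral_marginal (pdata := pdata) (α := α) (σ := σ) _ (hφ.continuous.comp hcont) t
  simp only [Function.comp] at e1
  rw [e1]
  refine tendsto_nhds_unique hlim (tendsto_const_nhds.congr' ?_)
  filter_upwards [self_mem_nhdsWithin, nhdsWithin_le_nhds (lt_mem_nhds hst')] with r hr hsr
  rw [← hsched.integral_flowMap_eq_of_lt hmoment hs hsr.le hr hφ hφ1 hφρ]
  exact integral_marginal _ (hφ.continuous.comp (hv.continuous_flowMap hs hsr.le (le_of_lt hr))) r

end IsNoiseSchedule

end Pushforward

/-! ### Solutions, flow and transport down to time zero -/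

section TimeZero

variable {D : ℕ} {v : ℝ → Space D → Space D} {T : ℝ}

theorem isSolution_self (v : ℝ → Space D → Space D) (t : ℝ) (x : Space D) {γ : ℝ → Space D} :
    IsSolution v t t x γ ↔ γ t = x := by
  refine ⟨fun h => h.self, fun h => ⟨IntervalIntegrable.refl, fun r hr => ?_⟩⟩
  rw [uIcc_self, mem_singleton_iff] at hr
  rw [hr, intervalIntegral.integral_same, add_zero, h]

theorem hasUniqueSolution_self (v : ℝ → Space D → Space D) (t : ℝ) (x : Space D) :
    HasUniqueSolution v t t x := by
  refine ⟨fun _ => x, (isSolution_self v t x).2 rfl, fun γ hγ r hr => ?_⟩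
  rw [uIcc_self, mem_singleton_iff] at hr
  rw [hr, hγ.self]

theorem flowMap_self (v : ℝ → Space D → Space D) (t : ℝ) (x : Space D) : flowMap v t t x = x := by
  have hex : ∃ γ, IsSolution v t t x γ := ⟨fun _ => x, (isSolution_self v t x).2 rfl⟩
  rw [flowMap, dif_pos hex]
  exact hex.choose_spec.self

namespace IsRegularField

variable (hv : IsRegularField T v) {t : ℝ} {x : Space D}
include hv

theorem eq_flowMap_of_isSolution_zero (htT : t ≤ T) {γ : ℝ → Space D}
    (h : IsSolution v t 0 x γ) {r : ℝ} (hr : r ∈ Ioc 0 t) : γ r = flowMap v t r x := by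
  have hmem : r ∈ uIcc t 0 := by
    rw [uIcc_of_ge (hr.1.le.trans hr.2)]
    exact ⟨hr.1.le, hr.2⟩
  obtain ⟨h1, h2⟩ := (hv.isSolution_iff hr.1 hr.2 htT).1 (h.mono hmem)
  rw [← h2]
  exact (hv.flowMap_eq_of_isCurveOn hr.1 hr.2 htT h1).symm

/-- A drift that is integrable along the flow leads to a solution down to time zero. -/
theorem exists_isSolution_zero (ht : 0 < t) (htT : t ≤ T)
    (hint : IntegrableOn (fun u => v u (flowMap v t u x)) (Ioc 0 t)) :
    ∃ γ, IsSolution v t 0 x γ := by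
  set γ : ℝ → Space D := fun r => x + ∫ u in t..r, v u (flowMap v t u x) with hγ
  have heq : ∀ r ∈ Ioc 0 t, γ r = flowMap v t r x := fun r hr =>
    (((hv.isSolution_iff hr.1 hr.2 htT).2 (hv.isCurveOn_flowMap hr.1 hr.2 htT x)).2 r
      right_mem_uIcc).symm
  have hI : IntervalIntegrable (fun u => v u (flowMap v t u x)) volume t 0 :=
    ((intervalIntegrable_iff_integrableOn_Ioc_of_le ht.le).2 hint).symm
  refine ⟨γ, hI.congr fun u hu => ?_, fun r hr => ?_⟩
  · rw [uIoc_of_ge ht.le] at hu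
    simp only [heq u hu]
  · rw [uIcc_of_ge ht.le] at hr
    rw [hγ]
    simp only
    congr 1
    refine intervalIntegral.integral_congr_ae (.of_forall fun u hu => ?_)
    rw [uIoc_of_ge hr.2] at hu
    have := heq u ⟨hr.1.trans_lt hu.1, hu.2⟩
    simp only [hγ] at this
    rw [this]

/-- On `(0, t]` every solution is the flow; the integral equation then fixes its value at zero,
because the integrand is already determined almost everywhere. -/
theorem hasUniqueSolution_zero (ht : 0 < t) (htT : t ≤ T) (hex : ∃ γ, IsSolution v t 0 x γ) :
    HasUniqueSolution v t 0 x := by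
  obtain ⟨γ, hγ⟩ := hex
  refine ⟨γ, hγ, fun γ' hγ' r hr => ?_⟩
  have heq : ∀ u ∈ Ioc 0 t, γ' u = γ u := fun u hu =>
    (hv.eq_flowMap_of_isSolution_zero htT hγ' hu).trans
      (hv.eq_flowMap_of_isSolution_zero htT hγ hu).symm
  rw [hγ.2 r hr, hγ'.2 r hr]
  rw [uIcc_of_ge ht.le] at hr
  congr 1
  refine intervalIntegral.integral_congr_ae (.of_forall fun u hu => ?_)
  rw [uIoc_of_ge hr.2] at hu
  rw [heq u ⟨hr.1.trans_lt hu.1, hu.2⟩]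

/-- A solution on the closed interval is continuous, so the flow to time zero is the limit of flows
to positive times. -/
theorem tendsto_flowMap_zero (ht : 0 < t) (htT : t ≤ T) (hex : ∃ γ, IsSolution v t 0 x γ) :
    Tendsto (fun s => flowMap v t s x) (𝓝[Ioc 0 t] 0) (𝓝 (flowMap v t 0 x)) := by
  have hval : flowMap v t 0 x = hex.choose 0 := by rw [flowMap, dif_pos hex]
  rw [hval]
  have hcont := hex.choose_spec.continuousOn
  rw [uIcc_of_ge ht.le] at hcont
  refine ((hcont 0 (left_mem_Icc.2 ht.le)).mono_left
    (nhdsWithin_mono _ Ioc_subset_Icc_self)).congr' ?_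
  filter_upwards [self_mem_nhdsWithin] with r hr
  exact hv.eq_flowMap_of_isSolution_zero htT hex.choose_spec hr

/-- The semigroup law at positive times passes to the limit. Both existence hypotheses are needed
for the two limits at zero. -/
theorem flowMap_flowMap_zero {s : ℝ} (hs : 0 < s) (hst : s ≤ t) (htT : t ≤ T)
    (hex : ∃ γ, IsSolution v t 0 x γ) (hex' : ∃ γ, IsSolution v s 0 (flowMap v t s x) γ) :
    flowMap v s 0 (flowMap v t s x) = flowMap v t 0 x := by
  have h1 := (hv.tendsto_flowMap_zero (hs.trans_le hst) htT hex).mono_left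
    (nhdsWithin_mono _ (Ioc_subset_Ioc_right hst))
  have h2 := hv.tendsto_flowMap_zero hs (hst.trans htT) hex'
  have hne : (𝓝[Ioc 0 s] (0 : ℝ)).NeBot := by
    rw [nhdsWithin_Ioc_eq_nhdsGT hs]
    infer_instance
  refine tendsto_nhds_unique h2 (h1.congr' ?_)
  filter_upwards [self_mem_nhdsWithin] with r hr
  exact (hv.flowMap_flowMap hr.1 hr.2 hst htT x).symm

end IsRegularField

variable {pdata : Measure (Space D)} [IsProbabilityMeasure pdata] {α σ : ℝ → ℝ}

namespace IsNoiseSchedule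

variable (hsched : IsNoiseSchedule T α σ) (hmoment : Integrable (fun x : Space D => x) pdata)
include hsched hmoment

-- Absolute continuity of the schedules enters here, as integrability of their derivatives.
omit [IsProbabilityMeasure pdata] in
theorem lintegral_enorm_derivWithin_schedule_lt_top {t : ℝ} (htT : t ≤ T) :
    ∫⁻ u in Ioc 0 t, (‖derivWithin α (Ioc 0 T) u‖ₑ * ∫⁻ x, ‖x‖ₑ ∂pdata +
      ‖derivWithin σ (Ioc 0 T) u‖ₑ * ∫⁻ x, ‖x‖ₑ ∂(stdGaussian (Space D))) < ⊤ := by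
  have hα := hsched.integrableOn_signal.mono_set (Ioc_subset_Ioc_right htT)
  have hσ := hsched.integrableOn_noise.mono_set (Ioc_subset_Ioc_right htT)
  have hα1 : AEMeasurable (fun u => ‖derivWithin α (Ioc 0 T) u‖ₑ) (volume.restrict (Ioc 0 t)) :=
    hα.1.enorm
  have hσ1 : AEMeasurable (fun u => ‖derivWithin σ (Ioc 0 T) u‖ₑ) (volume.restrict (Ioc 0 t)) :=
    hσ.1.enorm
  rw [lintegral_add_left' (hα1.mul_const _), lintegral_mul_const'' _ hα1,
    lintegral_mul_const'' _ hσ1]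
  exact ENNReal.add_lt_top.2 ⟨ENNReal.mul_lt_top hα.2 hmoment.2, ENNReal.mul_lt_top hσ.2
    (IsGaussian.integrable_id (μ := stdGaussian (Space D))).2⟩

/-- By transport, the flow started from `p_t` has law `p_u` at time `u`, so the Jensen bound applies
along trajectories. -/
theorem lintegral_enorm_velocity_flowMap_le {t u : ℝ} (hu : u ∈ Ioc 0 t) (htT : t ≤ T) :
    ∫⁻ x, ‖velocity pdata T α σ u (flowMap (velocity pdata T α σ) t u x)‖ₑ
        ∂(marginal pdata α σ t) ≤
      ‖derivWithin α (Ioc 0 T) u‖ₑ * ∫⁻ x, ‖x‖ₑ ∂pdata +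
        ‖derivWithin σ (Ioc 0 T) u‖ₑ * ∫⁻ x, ‖x‖ₑ ∂(stdGaussian (Space D)) := by
  have hv := hsched.isRegularField_velocity hmoment
  have hvm : Measurable (velocity pdata T α σ u) := (hv.continuousOn.comp_continuous
    (Continuous.prodMk_right u) fun x => ⟨⟨hu.1, hu.2.trans htT⟩, mem_univ _⟩).measurable
  have h1 := lintegral_map (μ := marginal pdata α σ t) hvm.enorm
    (hv.continuous_flowMap hu.1 hu.2 htT).measurable
  rw [hsched.map_flowMap_marginal hmoment hu.1 hu.2 htT] at h1
  rw [← h1]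
  exact lintegral_enorm_velocity_le hmoment
    (hsched.noise_pos u ⟨hu.1, hu.2.trans htT⟩).ne' hvm

/-- Almost every trajectory of the probability-flow ODE has finite length down to time zero. -/
theorem ae_integrableOn_velocity_flowMap {t : ℝ} (htT : t ≤ T) :
    ∀ᵐ x ∂(marginal pdata α σ t), IntegrableOn
      (fun u => velocity pdata T α σ u (flowMap (velocity pdata T α σ) t u x)) (Ioc 0 t) := by
  have hv := hsched.isRegularField_velocity hmoment
  have hle := fun u hu => hsched.lintegral_enorm_velocity_flowMap_le hmoment (u := u) hu htT
  have hfin := hsched.lintegral_enorm_derivWithin_schedule_lt_top hmoment htT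
  generalize velocity pdata T α σ = v at *
  have hflow : ContinuousOn (fun p : ℝ × Space D => v p.1 (flowMap v t p.1 p.2))
      (Ioc 0 t ×ˢ univ) :=
    hv.continuousOn.comp (continuousOn_fst.prodMk (hv.continuousOn_flowMap_uncurry htT))
      fun p hp => ⟨⟨hp.1.1, hp.1.2.trans htT⟩, mem_univ _⟩
  have hmeas : AEStronglyMeasurable (fun p : ℝ × Space D => v p.1 (flowMap v t p.1 p.2))
      ((volume.restrict (Ioc 0 t)).prod (marginal pdata α σ t)) := by
    have := hflow.aestronglyMeasurable (μ := (volume : Measure ℝ).prod (marginal pdata α σ t))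
      (measurableSet_Ioc.prod MeasurableSet.univ)
    rwa [← Measure.prod_restrict, Measure.restrict_univ] at this
  have henorm : AEMeasurable (fun p : ℝ × Space D => ‖v p.1 (flowMap v t p.1 p.2)‖ₑ)
      ((volume.restrict (Ioc 0 t)).prod (marginal pdata α σ t)) := hmeas.enorm
  -- Tonelli: the expected length of a trajectory is the time integral of its mean speed.
  have hfin' : ∫⁻ x, (∫⁻ u in Ioc 0 t, ‖v u (flowMap v t u x)‖ₑ) ∂(marginal pdata α σ t) < ⊤ := by
    rw [← lintegral_lintegral_swap (f := fun u x => ‖v u (flowMap v t u x)‖ₑ) henorm]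
    refine lt_of_le_of_lt (lintegral_mono_ae ?_) hfin
    exact (ae_restrict_iff' measurableSet_Ioc).2 (.of_forall hle)
  have hmx := ae_lt_top' henorm.lintegral_prod_left' hfin'.ne
  filter_upwards [hmx] with x hx
  refine ⟨?_, hx⟩
  refine ContinuousOn.aestronglyMeasurable (hflow.comp
    (Continuous.prodMk_left x).continuousOn fun u hu => ⟨hu, mem_univ _⟩) measurableSet_Ioc

theorem ae_exists_isSolution_zero {t : ℝ} (ht : 0 < t) (htT : t ≤ T) :
    ∀ᵐ x ∂(marginal pdata α σ t), ∃ γ, IsSolution (velocity pdata T α σ) t 0 x γ :=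
  (hsched.ae_integrableOn_velocity_flowMap hmoment htT).mono fun _ hx =>
    (hsched.isRegularField_velocity hmoment).exists_isSolution_zero ht htT hx

/-- The map is an almost everywhere limit of continuous maps, since almost every trajectory reaches
time zero. -/
theorem aemeasurable_flowMap_zero {t : ℝ} (ht : 0 < t) (htT : t ≤ T) :
    AEMeasurable (flowMap (velocity pdata T α σ) t 0) (marginal pdata α σ t) := by
  have hv := hsched.isRegularField_velocity hmoment
  have hne : (𝓝[Ioc 0 t] (0 : ℝ)).NeBot := by
    rw [nhdsWithin_Ioc_eq_nhdsGT ht]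
    infer_instance
  have hmem : ∀ n : ℕ, t / ((n : ℝ) + 1) ∈ Ioc 0 t := fun n =>
    ⟨by positivity, div_le_self ht.le (by linarith [(Nat.cast_nonneg n : (0 : ℝ) ≤ n)])⟩
  have hlim : Tendsto (fun n : ℕ => t / ((n : ℝ) + 1)) atTop (𝓝[Ioc 0 t] 0) := by
    refine tendsto_nhdsWithin_iff.2 ⟨?_, .of_forall hmem⟩
    have := (tendsto_one_div_add_atTop_nhds_zero_nat (𝕜 := ℝ)).const_mul t
    simpa only [mul_zero, mul_one_div] using this
  refine aemeasurable_of_tendsto_metrizable_ae atTop (fun n : ℕ =>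
    (hv.continuous_flowMap (hmem n).1 (hmem n).2 htT).aemeasurable) ?_
  filter_upwards [hsched.ae_exists_isSolution_zero hmoment ht htT] with x hx
  exact (hv.tendsto_flowMap_zero ht htT hx).comp hlim

/-- The flow of the probability-flow ODE transports the marginals down to time zero. -/
theorem map_flowMap_zero_marginal {t : ℝ} (ht : 0 < t) (htT : t ≤ T) :
    (marginal pdata α σ t).map (flowMap (velocity pdata T α σ) t 0) = marginal pdata α σ 0 := by
  have hv := hsched.isRegularField_velocity hmoment
  have hae := hsched.aemeasurable_flowMap_zero hmoment ht htT
  have hne : (𝓝[Ioc 0 t] (0 : ℝ)).NeBot := by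
    rw [nhdsWithin_Ioc_eq_nhdsGT ht]
    infer_instance
  have := Measure.isProbabilityMeasure_map hae
  refine Measure.ext_of_forall_lipschitz fun C ρ φ hφ hφ1 hφρ => ?_
  rw [integral_map hae hφ.continuous.aestronglyMeasurable]
  have hlim : Tendsto (fun s => ∫ x, φ (flowMap (velocity pdata T α σ) t s x)
      ∂(marginal pdata α σ t)) (𝓝[Ioc 0 t] 0)
      (𝓝 (∫ x, φ (flowMap (velocity pdata T α σ) t 0 x) ∂(marginal pdata α σ t))) := by
    refine tendsto_integral_filter_of_dominated_convergence (fun _ => 1) ?_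
      (.of_forall fun R => .of_forall fun x => hφ1 _) (integrable_const _) ?_
    · filter_upwards [self_mem_nhdsWithin] with s hs
      exact (hφ.continuous.comp (hv.continuous_flowMap hs.1 hs.2 htT)).aestronglyMeasurable
    · filter_upwards [hsched.ae_exists_isSolution_zero hmoment ht htT] with x hx
      exact (hφ.continuous.tendsto _).comp (hv.tendsto_flowMap_zero ht htT hx)
  have hlim' : Tendsto (fun s => ∫ x, φ x ∂(marginal pdata α σ s)) (𝓝[Ioc 0 t] 0)
      (𝓝 (∫ x, φ x ∂(marginal pdata α σ 0))) := by
    simp only [integral_marginal φ hφ.continuous]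
    refine tendsto_integral_filter_of_dominated_convergence (fun _ => 1)
      (.of_forall fun s => Continuous.aestronglyMeasurable
        (hφ.continuous.comp (continuous_interpolant (α s) (σ s))))
      (.of_forall fun R => .of_forall fun x => hφ1 _) (integrable_const _) (.of_forall fun z => ?_)
    have hmem : (0 : ℝ) ∈ Icc 0 T := ⟨le_rfl, ht.le.trans htT⟩
    have hle : 𝓝[Ioc 0 t] (0 : ℝ) ≤ 𝓝[Icc 0 T] 0 :=
      nhdsWithin_mono _ fun s hs => ⟨hs.1.le, hs.2.trans htT⟩
    have h1 := (((hsched.continuousOn_signal 0 hmem).mono_left hle).smul_const z.1).add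
      (((hsched.continuousOn_noise 0 hmem).mono_left hle).smul_const z.2)
    exact (hφ.continuous.tendsto _).comp h1
  refine tendsto_nhds_unique hlim (hlim'.congr' ?_)
  filter_upwards [self_mem_nhdsWithin] with s hs
  rw [← hsched.map_flowMap_marginal hmoment hs.1 hs.2 htT,
    integral_map (hv.continuous_flowMap hs.1 hs.2 htT).aemeasurable
      hφ.continuous.aestronglyMeasurable]

/-- Transporting a pair (state at time `t`, state at time `0`) back to the terminal time. -/
theorem lintegral_flowMap_pair {t : ℝ} (ht : t ∈ Icc 0 T) (hT : 0 < T)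
    {G : Space D × Space D → ℝ≥0∞} (hG : Measurable G) :
    ∫⁻ x, G (x, flowMap (velocity pdata T α σ) t 0 x) ∂(marginal pdata α σ t) =
      ∫⁻ x, G (flowMap (velocity pdata T α σ) T t x, flowMap (velocity pdata T α σ) T 0 x)
        ∂(marginal pdata α σ T) := by
  have hv := hsched.isRegularField_velocity hmoment
  rcases ht.1.eq_or_lt with rfl | ht0
  -- At `t = 0` the pair is `(x, x)`, and transport from `T` to zero suffices.
  · simp only [flowMap_self]
    have hmeas : Measurable fun x => G (x, x) := hG.comp (by fun_prop)
    rw [← hsched.map_flowMap_zero_marginal hmoment hT le_rfl,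
      lintegral_map' hmeas.aemeasurable (hsched.aemeasurable_flowMap_zero hmoment hT le_rfl)]
  · have hcont := hv.continuous_flowMap ht0 ht.2 le_rfl
    have hmap := hsched.map_flowMap_marginal hmoment ht0 ht.2 le_rfl
    have hae : AEMeasurable (fun x => G (x, flowMap (velocity pdata T α σ) t 0 x))
        (marginal pdata α σ t) :=
      hG.comp_aemeasurable
        (aemeasurable_id.prodMk (hsched.aemeasurable_flowMap_zero hmoment ht0 ht.2))
    have hsol := hsched.ae_exists_isSolution_zero hmoment ht0 ht.2
    -- With `p_t` written as the image of `p_T`, almost every `x_T` is sent to a point from which a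
    -- solution reaches zero, as the semigroup law requires.
    rw [← hmap] at hae hsol ⊢
    rw [lintegral_map' hae hcont.aemeasurable]
    refine lintegral_congr_ae ?_
    filter_upwards [ae_of_ae_map hcont.aemeasurable hsol,
      hsched.ae_exists_isSolution_zero hmoment hT le_rfl] with x hx hx'
    rw [hv.flowMap_flowMap_zero ht0 ht.2 le_rfl hx' hx]

end IsNoiseSchedule

end TimeZero

/-! ### The main theorem -/

theorem theorem1 {D : ℕ} {Θ : Type*}
    (T : ℝ) (hT : 0 < T)
    (α σ : ℝ → ℝ) (hsched : IsNoiseSchedule T α σ)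
    (pdata : Measure (Space D)) [IsProbabilityMeasure pdata]
    (hmoment : Integrable (fun x : Space D => x) pdata)
    (pprior : Measure (Space D)) (hprior : pprior = marginal pdata α σ T)
    (timeLaw : Measure ℝ) [IsProbabilityMeasure timeLaw]
    (htime : ∀ᵐ t ∂timeLaw, t ∈ Icc 0 T)
    (w : ℝ → ℝ≥0) (hw : Measurable w)
    (d : Space D → Space D → ℝ≥0) (hd : Measurable (fun z : Space D × Space D => d z.1 z.2))
    (f : Θ → Space D → ℝ → Space D)
    (hf : ∀ θ, Measurable (fun z : Space D × ℝ => f θ z.1 z.2)) :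
    (∀ t ∈ Icc 0 T, ∀ᵐ x ∂(marginal pdata α σ t),
      HasUniqueSolution (velocity pdata T α σ) t 0 x) ∧
    ∀ θ : Θ,
      oracleLoss pdata T α σ timeLaw w d (f θ) =
        ∫⁻ t, ∫⁻ xT,
          ((w t * d (f θ (flowMap (velocity pdata T α σ) T t xT) t)
            (flowMap (velocity pdata T α σ) T 0 xT) : ℝ≥0) : ℝ≥0∞) ∂pprior ∂timeLaw := by
  have hv := hsched.isRegularField_velocity hmoment
  refine ⟨fun t ht => ?_, fun θ => ?_⟩
  · rcases ht.1.eq_or_lt with rfl | ht0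
    · exact .of_forall fun x => hasUniqueSolution_self _ _ x
    · exact (hsched.ae_exists_isSolution_zero hmoment ht0 ht.2).mono fun x hx =>
        hv.hasUniqueSolution_zero ht0 ht.2 hx
  · rw [oracleLoss, hprior]
    -- The inner integrals agree for each fixed `t ∈ [0, T]`, so their measurability in `t` plays no
    -- role.
    refine lintegral_congr_ae (htime.mono fun t ht => ?_)
    have hG : Measurable fun z : Space D × Space D =>
        ((w t * d (f θ z.1 t) z.2 : ℝ≥0) : ℝ≥0∞) := by
      have h1 : Measurable fun z : Space D × Space D => f θ z.1 t :=
        (hf θ).comp (by fun_prop : Measurable fun z : Space D × Space D => (z.1, t))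
      have h2 : Measurable fun z : Space D × Space D => d (f θ z.1 t) z.2 :=
        hd.comp (h1.prodMk measurable_snd)
      exact (h2.const_mul (w t)).coe_nnreal_ennreal
    exact hsched.lintegral_flowMap_pair hmoment ht hT hG
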